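/- Fix $L$ nonlinearities $\sigma_i:\mathbb{R}^{m_i}\to\mathbb{R}^{d_i}$ ($1\le i\le L$), where $\sigma_i$ is $\rho_i$-Lipschitz for the Euclidean norms and $\sigma_i(0)=0$, and reference matrices $M_i\in\mathbb{R}^{m_i\times d_{i-1}}$. Write $d=d_0$, $k=d_L$, and let $W$ be the maximum of all the dimensions $d_0,\ldots,d_L,m_1,\ldots,m_L$. For weight matrices $\mathcal{A}=(A_1,\ldots,A_L)$ with $A_i\in\mathbb{R}^{m_i\times d_{i-1}}$ let $$F_{\mathcal A}(x)=\sigma_L(A_L\sigma_{L-1}(A_{L-1}\cdots\sigma_1(A_1x)\cdots)),\qquad F_{\mathcal A}:\mathbb{R}^d\to\mathbb{R}^k .$$ Let $\|\cdot\|_\sigma$ be the spectral norm, and let $\|A\|_{2,1}$ be the sum of the Euclidean norms of the columns of $A$. For $v\in\mathbb{R}^k$ and $y\in\{1,\ldots,k\}$ let $\mathcal{M}(v,y)=v_y-\max_{j\ne y}v_j$. For $\gamma>0$ let $\ell_\gamma(r)=0$ for $r<-\gamma$, $\ell_\gamma(r)=1+r/\gamma$ for $-\gamma\le r\le 0$ and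 $\ell_\gamma(r)=1$ for $r>0$; for a sample $((x_i,y_i))_{i=1}^n$ let $\widehat{\mathcal R}_\gamma(f)=\frac1n\sum_{i=1}^n\ell_\gamma(-\mathcal{M}(f(x_i),y_i))$. The $\arg\max$ below uses an arbitrary fixed rule for breaking ties. Let a margin $\gamma>0$, a data bound $B$, spectral norm bounds $s_1,\ldots,s_L>0$, $(2,1)$ norm bounds $b_1,\ldots,b_L$, an integer $n\ge1$ and $\delta\in(0,1]$ be given, and let $(x,y),(x_1,y_1),\ldots,(x_n,y_n)$ be drawn iid from an arbitrary probability distribution on $\mathbb{R}^d\times\{1,\ldots,k\}$. Then with probability at least $1-\delta$ over $((x_i,y_i))_{i=1}^n$ the following holds: if $\sqrt{\sum_i\|x_i\|_2^2}\le B$, then every $\mathcal{A}=(A_1,\ldots,A_L)$ with $\|A_i\|_\sigma\le s_i$ and $\|A_i^\top-M_i^\top\|_{2,1}\le b_i$ for all $i$ satisfies $$\Pr\Big[\arg\max_jF_{\mathcal A}(x)_j\ne y\Big]\le\widehat{\mathcal R}_\gamma(F_{\mathcal A})+\frac8n+\frac{72B\ln(2W)\ln(n)}{\gamma n}\Big(\prod_{i=1}^Ls_i\rho_i\Big)\Big(\sum_{i=1}^L\frac{b_i^{2/3}}{s_i^{2/3}}\Big)^{3/2}+3\sqrt{\frac{\ln(1/\delta)}{2n}}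 .$$ -/

import Mathlib

open MeasureTheory
open scoped NNReal Matrix

namespace SpectralMargin

/-- Euclidean space of dimension `a`, with the `l₂` norm. -/
abbrev E (a : ℕ) : Type := EuclideanSpace ℝ (Fin a)

/-- The spectral norm of a matrix: its operator norm with respect to the `l₂` norms. -/
noncomputable def specNorm {a b : ℕ} (A : Matrix (Fin a) (Fin b) ℝ) : ℝ :=
  ‖LinearMap.toContinuousLinearMap (Matrix.toEuclideanLin A)‖

/-- The `(2,1)` matrix norm: the sum over the columns of their `l₂` norms. -/
noncomputable def norm21 {a b : ℕ} (A : Matrix (Fin a) (Fin b) ℝ) : ℝ :=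
  ∑ j, Real.sqrt (∑ i, A i j ^ 2)

/-- The network `x ↦ σ_L (A_L σ_{L-1} (A_{L-1} ⋯ σ_1 (A_1 x) ⋯))`. Layer `i` (counted from `0`)
maps `ℝ^(d i)` linearly to `ℝ^(m i)` by `A i`, then to `ℝ^(d (i+1))` by the nonlinearity `σ i`. -/
noncomputable def network {L : ℕ} {d : Fin (L + 1) → ℕ} {m : Fin L → ℕ}
    (σ : ∀ i : Fin L, E (m i) → E (d i.succ))
    (A : ∀ i : Fin L, Matrix (Fin (m i)) (Fin (d i.castSucc)) ℝ)
    (x : E (d 0)) : E (d (Fin.last L)) :=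
  Fin.induction (motive := fun l => E (d l)) x
    (fun i z => σ i (Matrix.toEuclideanLin (A i) z)) (Fin.last L)

/-- The maximal width `W`: the largest of all dimensions occurring in the network. -/
def width {L : ℕ} (d : Fin (L + 1) → ℕ) (m : Fin L → ℕ) : ℕ :=
  max (Finset.univ.sup d) (Finset.univ.sup m)

/-- The margin operator `v_y - max_{j ≠ y} v_j`. -/
noncomputable def margin {k : ℕ} (v : E k) (y : Fin k) : ℝ :=
  v y - ⨆ j : {j : Fin k // j ≠ y}, v j

/-- The ramp loss. -/
noncomputable def ramp (γ r : ℝ) : ℝ :=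
  if r < -γ then 0 else if r ≤ 0 then 1 + r / γ else 1

/-- The empirical ramp risk of `f` on the sample `S`. -/
noncomputable def empRampRisk {a k n : ℕ} (γ : ℝ) (f : E a → E k) (S : Fin n → E a × Fin k) : ℝ :=
  (n : ℝ)⁻¹ * ∑ i, ramp γ (-margin (f (S i).1) (S i).2)

/-- A classification rule `v ↦ argmax_j v_j`, with arbitrary breaking of ties. -/
def IsArgmax {k : ℕ} (am : E k → Fin k) : Prop :=
  ∀ (v : E k) (j : Fin k), v j ≤ v (am v)

/-- The probability that the predictor `f`, with the rule `am`, misclassifies `(x, y) ∼ μ`. -/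
noncomputable def errorProb {a k : ℕ} (μ : Measure (E a × Fin k)) (am : E k → Fin k)
    (f : E a → E k) : ℝ :=
  μ.real {p | am (f p.1) ≠ p.2}

end SpectralMargin

/-! The error probability is at most the expected ramp loss, because a misclassified point has
nonpositive margin and hence loss 1. It remains to bound, uniformly over the admissible weights, the
gap between expected and empirical ramp loss, through the metric entropy of the network outputs on
the sample.

Entropy. Fix the sample as a batch `X` with its Frobenius norm. The image of `X` under `A - M` is a
combination of rank one batches of norm at most 1, with coefficients of total size at most `norm21
(Aᵀ - Mᵀ) * ‖X‖`. Maurey's argument therefore approximates it by sums of few signed vertices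
(`exists_finset_approx_of_sum_abs_le`). Applied layer by layer, this gives a tree of covers whose
relative errors add and whose log-cardinalities add (`exists_layerOutput_cover`). Distributing the
number of vertices optimally over the layers yields log-cardinality of order `Q ^ 2 / ε ^ 2`, up to
a logarithm of the width, where `Q` is `B` times the product and the power `3 / 2` of the sum in the
bound (`exists_network_cover`).

Chaining. For entropy `q ^ 2 / ε ^ 2`, every dyadic scale contributes the same amount `6 * q` to the
Rademacher average, so about `log n` scales leave only a bounded residual
(`rademacher_le_of_entropy`).

Probability. For a finite class, McDiarmid's inequality is applied once, to the maximal deviation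
minus twice the empirical Rademacher average. This difference has nonpositive mean by
symmetrization, so the confidence term costs a single `δ` (`measureReal_maxDeviation_gt_le`). Since
the loss is continuous in the weights, a dense sequence of weights and continuity from below extend
the bound to the whole class, and the entropy estimate is needed only on samples with norm at most
`B` (`measure_exists_deviation_gt_le`). -/

namespace SpectralMargin

/-! ### Maurey sparsification in an inner product space -/

section Sparsification

variable {H : Type*} [NormedAddCommGroup H] [InnerProductSpace ℝ H]

/-- A linear functional is maximised over a symmetric convex hull at a signed vertex. -/
theorem exists_signed_vertex_inner_le {ι : Type*} [Fintype ι] [Nonempty ι] (V : ι → H)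
    (c : ι → ℝ) {β : ℝ} (hc : ∑ i, |c i| ≤ β) (y : H) :
    ∃ p : ι × Bool, inner ℝ y (∑ i, c i • V i) ≤
      inner ℝ y ((if p.2 then β else -β) • V p.1) := by
  obtain ⟨i₀, hi₀⟩ := Finite.exists_max fun i => |inner ℝ y (V i)|
  have h1 : inner ℝ y (∑ i, c i • V i) ≤ β * |inner ℝ y (V i₀)| := by
    rw [inner_sum]
    calc ∑ i, inner ℝ y (c i • V i) ≤ ∑ i, |c i| * |inner ℝ y (V i₀)| := by
          refine Finset.sum_le_sum fun i _ => ?_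
          rw [inner_smul_right]
          calc c i * inner ℝ y (V i) ≤ |c i * inner ℝ y (V i)| := le_abs_self _
            _ = |c i| * |inner ℝ y (V i)| := abs_mul _ _
            _ ≤ _ := mul_le_mul_of_nonneg_left (hi₀ i) (abs_nonneg _)
      _ = (∑ i, |c i|) * |inner ℝ y (V i₀)| := by rw [Finset.sum_mul]
      _ ≤ _ := mul_le_mul_of_nonneg_right hc (abs_nonneg _)
  rcases le_total 0 (inner ℝ y (V i₀)) with h | h
  · refine ⟨(i₀, true), ?_⟩
    rw [abs_of_nonneg h] at h1
    simpa [inner_smul_right] using h1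
  · refine ⟨(i₀, false), ?_⟩
    rw [abs_of_nonpos h] at h1
    simpa [inner_smul_right] using h1

/-- Greedy selection of vertices: each step increases the squared error by no more than the
variance of a random vertex with mean `U`. -/
theorem exists_sum_norm_sq_le {κ : Type*} (W : κ → H) {β : ℝ} (hW : ∀ p, ‖W p‖ ≤ β) (U : H)
    (hU : ∀ y, ∃ p, inner ℝ y U ≤ inner ℝ y (W p)) (a : H) (c : ℝ) (k : ℕ) :
    ∃ g : Fin k → κ, ‖a - c • ∑ t, (W (g t) - U)‖ ^ 2 ≤
      ‖a‖ ^ 2 + k * (c ^ 2 * (β ^ 2 - ‖U‖ ^ 2)) := by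
  induction k with
  | zero => exact ⟨fun i => i.elim0, by simp⟩
  | succ k ih =>
    obtain ⟨g, hg⟩ := ih
    set y := a - c • ∑ t, (W (g t) - U) with hy
    -- In the expanded square, the terms involving `W p` are `-2 * inner (c • y + c ^ 2 • U) (W p)`
    -- and `c ^ 2 * ‖W p‖ ^ 2`. The latter is at most `c ^ 2 * β ^ 2`, so only this linear
    -- functional has to be made at least as large as at `U`.
    obtain ⟨p, hp⟩ := hU (c • y + c ^ 2 • U)
    refine ⟨Fin.cons p g, ?_⟩
    have e : a - c • ∑ t, (W ((Fin.cons p g : Fin (k + 1) → κ) t) - U) = y - c • (W p - U) := by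
      rw [Fin.sum_univ_succ]
      simp only [Fin.cons_zero, Fin.cons_succ, hy, smul_add]
      abel
    clear_value y
    rw [e, norm_sub_sq_real, norm_smul, mul_pow, norm_sub_sq_real, inner_smul_right,
      inner_sub_right, Real.norm_eq_abs, sq_abs]
    have hb : ‖W p‖ ^ 2 ≤ β ^ 2 := pow_le_pow_left₀ (norm_nonneg _) (hW p) 2
    have hc := mul_le_mul_of_nonneg_left hb (sq_nonneg c)
    rw [inner_add_left, inner_add_left, inner_smul_left, inner_smul_left, inner_smul_left,
      inner_smul_left, real_inner_self_eq_norm_sq, real_inner_comm (W p) U] at hp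
    simp only [conj_trivial] at hp
    push_cast
    nlinarith

/-- Maurey's sparsification with shrinkage: `k` vertices approximate every point of a symmetric
convex hull of radius `β` within `β / (1 + √k)`. -/
theorem exists_finset_approx_of_sum_abs_le {ι : Type*} [Fintype ι] (V : ι → H)
    (hV : ∀ i, ‖V i‖ ≤ 1) {β : ℝ} (hβ : 0 ≤ β) (k : ℕ) {N : ℕ} (hN1 : 1 ≤ N)
    (hN : 2 * Fintype.card ι ≤ N) :
    ∃ C : Finset H, C.card ≤ N ^ k ∧ ∀ c : ι → ℝ, ∑ i, |c i| ≤ β →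
      ∃ v ∈ C, ‖∑ i, c i • V i - v‖ ≤ β / (1 + √k) := by
  classical
  rcases Nat.eq_zero_or_pos k with rfl | hk
  · refine ⟨{0}, by simp, fun c hc => ⟨0, by simp, ?_⟩⟩
    simp only [sub_zero, Nat.cast_zero, Real.sqrt_zero, add_zero, div_one]
    refine (norm_sum_le _ _).trans (le_trans (Finset.sum_le_sum fun i _ => ?_) hc)
    rw [norm_smul, Real.norm_eq_abs]
    exact mul_le_of_le_one_right (abs_nonneg _) (hV i)
  rcases isEmpty_or_nonempty ι with hι | hι
  · refine ⟨{0}, by simpa using Nat.one_le_pow _ _ hN1, fun c _ => ⟨0, by simp, ?_⟩⟩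
    simp only [Finset.univ_eq_empty, Finset.sum_empty, sub_self, norm_zero]
    positivity
  let W : ι × Bool → H := fun p => (if p.2 then β else -β) • V p.1
  have hW : ∀ p, ‖W p‖ ≤ β := by
    rintro ⟨i, s⟩
    have : ‖(if s then β else -β)‖ = β := by
      cases s <;> simp [abs_of_nonneg hβ]
    simp only [W, norm_smul, this]
    exact mul_le_of_le_one_right hβ (hV i)
  set r := √(k : ℝ) with hr
  have hk0 : (0 : ℝ) < k := by exact_mod_cast hk
  have hr0 : 0 < r := Real.sqrt_pos.2 hk0
  have hrk : r ^ 2 = k := Real.sq_sqrt hk0.le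
  -- The average of the `k` vertices is shrunk by `r / (1 + r)`. The bias `‖U‖ ^ 2 / (1 + r) ^ 2`
  -- then cancels the `-‖U‖ ^ 2` of the variance term, as `k * (1 / (r * (1 + r))) ^ 2 = 1 / (1 + r)
  -- ^ 2`, leaving exactly `β ^ 2 / (1 + r) ^ 2`.
  refine ⟨Finset.univ.image fun g : Fin k → ι × Bool => (1 / (r * (1 + r))) • ∑ t, W (g t),
    ?_, fun c hc => ?_⟩
  · refine Finset.card_image_le.trans ?_
    rw [Finset.card_univ, Fintype.card_fun, Fintype.card_fin, Fintype.card_prod, Fintype.card_bool]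
    exact Nat.pow_le_pow_left (by omega) k
  · set U := ∑ i, c i • V i with hU
    obtain ⟨g, hg⟩ := exists_sum_norm_sq_le W hW U
      (fun y => exists_signed_vertex_inner_le V c hc y) ((1 / (1 + r)) • U) (1 / (r * (1 + r))) k
    refine ⟨_, Finset.mem_image_of_mem _ (Finset.mem_univ g), ?_⟩
    have e : (1 / (1 + r)) • U - (1 / (r * (1 + r))) • ∑ t, (W (g t) - U) =
        U - (1 / (r * (1 + r))) • ∑ t, W (g t) := by
      rw [Finset.sum_sub_distrib, Finset.sum_const, Finset.card_univ, Fintype.card_fin, smul_sub,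
        ← Nat.cast_smul_eq_nsmul ℝ, smul_smul, ← hrk]
      have : (1 / (1 + r)) • U + (1 / (r * (1 + r)) * r ^ 2) • U = U := by
        rw [← add_smul]
        have : 1 / (1 + r) + 1 / (r * (1 + r)) * r ^ 2 = 1 := by field_simp
        rw [this, one_smul]
      nth_rewrite 3 [← this]
      abel
    rw [e] at hg
    refine abs_le_of_sq_le_sq' (hg.trans (le_of_eq ?_)) (by positivity) |>.2
    rw [norm_smul, Real.norm_of_nonneg (by positivity), ← hrk]
    field_simp
    ring

/-- The metric projection onto a ball does not increase distances to points of the ball. -/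
theorem exists_mem_closedBall_dist_le [CompleteSpace H] (R : ℝ) (hR : 0 ≤ R) (v : H) :
    ∃ w : H, ‖w‖ ≤ R ∧ ∀ u : H, ‖u‖ ≤ R → ‖u - w‖ ≤ ‖u - v‖ := by
  have hconv : Convex ℝ (Metric.closedBall (0 : H) R) := convex_closedBall _ _
  obtain ⟨w, hw, hmin⟩ := exists_norm_eq_iInf_of_complete_convex
    (Metric.nonempty_closedBall.2 hR) (Metric.isClosed_closedBall.isComplete) hconv v
  rw [norm_eq_iInf_iff_real_inner_le_zero hconv hw] at hmin
  refine ⟨w, by simpa using hw, fun u hu => ?_⟩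
  have h := hmin u (by simpa using hu)
  have e : u - v = (u - w) - (v - w) := by abel
  have h2 : ‖u - w‖ ^ 2 ≤ ‖u - v‖ ^ 2 := by
    rw [e, norm_sub_sq_real (u - w), real_inner_comm]
    nlinarith [sq_nonneg ‖v - w‖]
  exact abs_le_of_sq_le_sq' h2 (norm_nonneg _) |>.2

end Sparsification

/-! ### Batches and the cover of a single linear layer -/

/-- A batch of `n` points of `ℝ^a`, with the Frobenius norm. -/
abbrev Batch (n a : ℕ) : Type := PiLp 2 fun _ : Fin n => E a

/-- Apply a map to every point of a batch. -/
noncomputable def mapBatch {n a b : ℕ} (f : E a → E b) (X : Batch n a) : Batch n b :=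
  WithLp.toLp 2 fun t => f (X t)

@[simp]
theorem mapBatch_apply {n a b : ℕ} (f : E a → E b) (X : Batch n a) (t : Fin n) :
    mapBatch f X t = f (X t) := rfl

theorem norm_mapBatch_sub_le {n a b : ℕ} {f : E a → E b} {K : ℝ≥0} (hf : LipschitzWith K f)
    (X Y : Batch n a) : ‖mapBatch f X - mapBatch f Y‖ ≤ K * ‖X - Y‖ := by
  refine abs_le_of_sq_le_sq' ?_ (by positivity) |>.2
  rw [mul_pow, PiLp.norm_sq_eq_of_L2, PiLp.norm_sq_eq_of_L2, Finset.mul_sum]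
  refine Finset.sum_le_sum fun t _ => ?_
  rw [← mul_pow]
  exact pow_le_pow_left₀ (norm_nonneg _) (by simpa using hf.norm_sub_le (X t) (Y t)) 2

theorem norm_mapBatch_le {n a b : ℕ} {f : E a → E b} {K : ℝ≥0} (hf : LipschitzWith K f)
    (hf0 : f 0 = 0) (X : Batch n a) : ‖mapBatch f X‖ ≤ K * ‖X‖ := by
  have h := norm_mapBatch_sub_le hf X 0
  have h0 : mapBatch f (0 : Batch n a) = 0 := by
    ext t : 1
    simpa using hf0
  simpa [h0] using h

theorem lipschitzWith_toEuclideanLin {a b : ℕ} (A : Matrix (Fin a) (Fin b) ℝ) {s : ℝ≥0}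
    (hA : specNorm A ≤ s) : LipschitzWith s (Matrix.toEuclideanLin A) := by
  have := (LinearMap.toContinuousLinearMap (Matrix.toEuclideanLin A)).lipschitz
  exact this.weaken hA

/-- The rank one batch supported on the output coordinate `p.1`, proportional to the normalised
input coordinate `p.2` of the batch. -/
noncomputable def coordVertex {n a b : ℕ} (X : Batch n b) (p : Fin a × Fin b) : Batch n a :=
  WithLp.toLp 2 fun t => EuclideanSpace.single p.1 ((√(∑ t, X t p.2 ^ 2))⁻¹ * X t p.2)

theorem norm_coordVertex_le {n a b : ℕ} (X : Batch n b) (p : Fin a × Fin b) :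
    ‖coordVertex X p‖ ≤ 1 := by
  refine abs_le_of_sq_le_sq' ?_ zero_le_one |>.2
  rw [PiLp.norm_sq_eq_of_L2]
  simp only [coordVertex, PiLp.norm_single, Real.norm_eq_abs, sq_abs, mul_pow]
  rw [← Finset.mul_sum, inv_pow, Real.sq_sqrt (Finset.sum_nonneg fun _ _ => sq_nonneg _), one_pow]
  exact inv_mul_le_one

/-- This exhibits the image as a point of a scaled symmetric hull of vertices that depend on `X` but
not on `D`, as sparsification requires. -/
theorem mapBatch_toEuclideanLin_eq_sum {n a b : ℕ} (D : Matrix (Fin a) (Fin b) ℝ)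
    (X : Batch n b) : mapBatch (Matrix.toEuclideanLin D) X =
      ∑ p : Fin a × Fin b, (D p.1 p.2 * √(∑ t, X t p.2 ^ 2)) • coordVertex X p := by
  ext t i
  rw [mapBatch_apply, Matrix.ofLp_toLpLin, Matrix.toLin'_apply, Fintype.sum_prod_type]
  simp only [coordVertex, WithLp.ofLp_sum, Finset.sum_apply, WithLp.ofLp_smul, Pi.smul_apply,
    smul_eq_mul, Matrix.mulVec, dotProduct, PiLp.single_apply]
  rw [Finset.sum_comm]
  refine Finset.sum_congr rfl fun j _ => ?_
  simp only [mul_ite, mul_zero, Finset.sum_ite_eq, Finset.mem_univ, if_true]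
  -- If an input coordinate vanishes on the whole batch, its normalisation is `0⁻¹ = 0` and both
  -- sides are zero.
  by_cases h : √(∑ t, X t j ^ 2) = 0
  · rw [Real.sqrt_eq_zero (Finset.sum_nonneg fun _ _ => sq_nonneg _),
      Finset.sum_eq_zero_iff_of_nonneg fun _ _ => sq_nonneg _] at h
    have := h t (Finset.mem_univ t)
    rw [sq_eq_zero_iff] at this
    simp [this]
  · field_simp

/-- Cauchy–Schwarz in each row of `D`, against the vector of coordinate norms of the batch, whose
Euclidean norm is `‖X‖`. -/
theorem sum_abs_coeff_le {n a b : ℕ} (D : Matrix (Fin a) (Fin b) ℝ) (X : Batch n b) :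
    ∑ p : Fin a × Fin b, |D p.1 p.2 * √(∑ t, X t p.2 ^ 2)| ≤ norm21 Dᵀ * ‖X‖ := by
  rw [Fintype.sum_prod_type, norm21, Finset.sum_mul]
  refine Finset.sum_le_sum fun i _ => ?_
  have hX : ‖X‖ = √(∑ j, (√(∑ t, X t j ^ 2)) ^ 2) := by
    rw [← Real.sqrt_sq (norm_nonneg X), PiLp.norm_sq_eq_of_L2]
    congr 1
    simp only [EuclideanSpace.norm_sq_eq, Real.norm_eq_abs, sq_abs]
    rw [Finset.sum_comm]
    exact Finset.sum_congr rfl fun j _ =>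
      (Real.sq_sqrt (Finset.sum_nonneg fun _ _ => sq_nonneg _)).symm
  rw [hX]
  have := Real.sum_mul_le_sqrt_mul_sqrt Finset.univ (fun j => |D i j|)
    (fun j => √(∑ t, X t j ^ 2))
  simp only [abs_mul, abs_of_nonneg (Real.sqrt_nonneg _), Matrix.transpose_apply]
  simpa only [sq_abs] using this

/-- Covering of the images of a batch under a bounded set of matrices. -/
theorem exists_layer_cover {n a b : ℕ} (X : Batch n b) (M : Matrix (Fin a) (Fin b) ℝ)
    {s β : ℝ} (hs : 0 ≤ s) (hβ : 0 ≤ β) (k : ℕ) {N : ℕ} (hN1 : 1 ≤ N) (hN : 2 * (a * b) ≤ N) :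
    ∃ C : Finset (Batch n a), C.card ≤ N ^ k ∧ (∀ v ∈ C, ‖v‖ ≤ s * ‖X‖) ∧
      ∀ A : Matrix (Fin a) (Fin b) ℝ, specNorm A ≤ s → norm21 (Aᵀ - Mᵀ) ≤ β →
        ∃ v ∈ C, ‖mapBatch (Matrix.toEuclideanLin A) X - v‖ ≤ β * ‖X‖ / (1 + √k) := by
  classical
  obtain ⟨C, hC, hcov⟩ := exists_finset_approx_of_sum_abs_le (coordVertex (a := a) X)
    (norm_coordVertex_le X) (mul_nonneg hβ (norm_nonneg X)) k hN1 (by simpa using hN)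
  -- The images to be covered lie in the ball of radius `s * ‖X‖`, so projecting the cover onto it
  -- costs no accuracy. The cover elements then obey the norm bound that sets the scale of the next
  -- layer.
  choose P hP1 hP2 using
    exists_mem_closedBall_dist_le (H := Batch n a) (s * ‖X‖) (by positivity)
  refine ⟨C.image fun v => P (mapBatch (Matrix.toEuclideanLin M) X + v),
    Finset.card_image_le.trans hC, ?_, fun A hA hAM => ?_⟩
  · intro v hv
    obtain ⟨w, -, rfl⟩ := Finset.mem_image.1 hv
    exact hP1 _
  · obtain ⟨v, hv, hd⟩ := hcov _ ((sum_abs_coeff_le (A - M) X).trans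
      (mul_le_mul_of_nonneg_right (by rwa [Matrix.transpose_sub]) (norm_nonneg X)))
    rw [← mapBatch_toEuclideanLin_eq_sum] at hd
    refine ⟨_, Finset.mem_image_of_mem _ hv, ?_⟩
    refine (hP2 _ _ ?_).trans (le_of_eq_of_le ?_ hd)
    · have := norm_mapBatch_le (lipschitzWith_toEuclideanLin A (s := ⟨s, hs⟩) hA) (map_zero _) X
      exact this
    · congr 1
      ext t : 1
      simp only [PiLp.sub_apply, PiLp.add_apply, mapBatch_apply, map_sub, LinearMap.sub_apply]
      abel

/-! ### Covering the outputs of the whole network -/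

section Network

variable {L : ℕ} {d : Fin (L + 1) → ℕ} {m : Fin L → ℕ}

/-- The output of the first `l` layers of the network. -/
noncomputable def layerOutput (σ : ∀ i : Fin L, E (m i) → E (d i.succ))
    (A : ∀ i : Fin L, Matrix (Fin (m i)) (Fin (d i.castSucc)) ℝ) (l : Fin (L + 1))
    (x : E (d 0)) : E (d l) :=
  Fin.induction (motive := fun l => E (d l)) x
    (fun i z => σ i (Matrix.toEuclideanLin (A i) z)) l

theorem layerOutput_succ (σ : ∀ i : Fin L, E (m i) → E (d i.succ))
    (A : ∀ i : Fin L, Matrix (Fin (m i)) (Fin (d i.castSucc)) ℝ) (i : Fin L) (x : E (d 0)) :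
    layerOutput σ A i.succ x =
      σ i (Matrix.toEuclideanLin (A i) (layerOutput σ A i.castSucc x)) :=
  Fin.induction_succ _ _ _

/-- Each element `v` of the cover at one layer gets its own cover of the next, so cardinalities
multiply. The old error is amplified by `s i * ρ i`, and the new one is proportional to `‖v‖`, which
is at most `B` times the partial product. Relative to that product the errors simply add. -/
theorem exists_layerOutput_cover {n : ℕ} (σ : ∀ i : Fin L, E (m i) → E (d i.succ)) (ρ : Fin L → ℝ≥0)
    (hσ : ∀ i, LipschitzWith (ρ i) (σ i)) (hσ0 : ∀ i, σ i 0 = 0)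
    (M : ∀ i : Fin L, Matrix (Fin (m i)) (Fin (d i.castSucc)) ℝ) {B : ℝ}
    {s b : Fin L → ℝ} (hs : ∀ i, 0 < s i) (hb : ∀ i, 0 ≤ b i)
    (X : Batch n (d 0)) (hX : ‖X‖ ≤ B) (k : Fin L → ℕ) {N : ℕ} (hN1 : 1 ≤ N)
    (hN : ∀ i, 2 * (m i * d i.castSucc) ≤ N) (l : Fin (L + 1)) :
    ∃ C : Finset (Batch n (d l)), C.card ≤ N ^ Fin.partialSum k l ∧
      (∀ v ∈ C, ‖v‖ ≤ B * Fin.partialProd (fun i => s i * (ρ i : ℝ)) l) ∧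
      ∀ A : ∀ i : Fin L, Matrix (Fin (m i)) (Fin (d i.castSucc)) ℝ,
        (∀ i, specNorm (A i) ≤ s i) → (∀ i, norm21 ((A i)ᵀ - (M i)ᵀ) ≤ b i) →
        ∃ v ∈ C, ‖mapBatch (layerOutput σ A l) X - v‖ ≤
          B * Fin.partialProd (fun i => s i * (ρ i : ℝ)) l *
            Fin.partialSum (fun i => b i / s i / (1 + √(k i))) l := by
  classical
  induction l using Fin.induction with
  | zero =>
    refine ⟨{X}, by simp, by simpa using hX, fun A _ _ => ⟨X, by simp, ?_⟩⟩
    have : mapBatch (layerOutput σ A 0) X = X := rfl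
    simp [this]
  | succ i ih =>
    obtain ⟨C, hC, hCn, hCov⟩ := ih
    choose D hD1 hD2 hD3 using fun v : Batch n (d i.castSucc) =>
      exists_layer_cover v (M i) (hs i).le (hb i) (k i) hN1 (hN i)
    refine ⟨C.biUnion fun v => (D v).image (mapBatch (σ i)), ?_, ?_, fun A hA hAM => ?_⟩
    · rw [Fin.partialSum_succ, pow_add]
      refine Finset.card_biUnion_le.trans ?_
      refine (Finset.sum_le_card_nsmul _ _ (N ^ k i)
        fun v _ => Finset.card_image_le.trans (hD1 v)).trans ?_
      rw [smul_eq_mul]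
      exact Nat.mul_le_mul_right _ hC
    · intro w hw
      obtain ⟨v, hv, hw⟩ := Finset.mem_biUnion.1 hw
      obtain ⟨u, hu, rfl⟩ := Finset.mem_image.1 hw
      rw [Fin.partialProd_succ]
      calc _ ≤ ρ i * ‖u‖ := norm_mapBatch_le (hσ i) (hσ0 i) u
        _ ≤ ρ i * (s i * (B * Fin.partialProd (fun i => s i * (ρ i : ℝ)) i.castSucc)) := by
          refine mul_le_mul_of_nonneg_left ?_ (ρ i).2
          exact (hD2 v u hu).trans (mul_le_mul_of_nonneg_left (hCn v hv) (hs i).le)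
        _ = _ := by ring
    · obtain ⟨v, hv, hd⟩ := hCov A hA hAM
      obtain ⟨u, hu, hd'⟩ := hD3 v (A i) (hA i) (hAM i)
      refine ⟨mapBatch (σ i) u, Finset.mem_biUnion.2 ⟨v, hv, Finset.mem_image_of_mem _ hu⟩, ?_⟩
      have e : mapBatch (layerOutput σ A i.succ) X = mapBatch (σ i)
          (mapBatch (Matrix.toEuclideanLin (A i)) (mapBatch (layerOutput σ A i.castSucc) X)) := by
        ext t : 1
        simp only [mapBatch_apply, layerOutput_succ]
      rw [e, Fin.partialProd_succ, Fin.partialSum_succ]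
      set P := Fin.partialProd (fun i => s i * (ρ i : ℝ)) i.castSucc
      set T := Fin.partialSum (fun i => b i / s i / (1 + √(k i))) i.castSucc
      set Y := mapBatch (layerOutput σ A i.castSucc) X
      have hlin : ‖mapBatch (Matrix.toEuclideanLin (A i)) Y -
          mapBatch (Matrix.toEuclideanLin (A i)) v‖ ≤ s i * ‖Y - v‖ :=
        norm_mapBatch_sub_le
          (lipschitzWith_toEuclideanLin (A i) (s := ⟨s i, (hs i).le⟩) (hA i)) Y v
      have hsi := hs i
      have hu' : b i * ‖v‖ / (1 + √(k i)) ≤ s i * (B * P) * (b i / s i / (1 + √(k i))) := by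
        have : s i * (B * P) * (b i / s i / (1 + √(k i))) = b i * (B * P) / (1 + √(k i)) := by
          field_simp
        rw [this]
        exact div_le_div_of_nonneg_right (mul_le_mul_of_nonneg_left (hCn v hv) (hb i))
          (by positivity)
      calc _ ≤ ρ i * ‖mapBatch (Matrix.toEuclideanLin (A i)) Y - u‖ :=
            norm_mapBatch_sub_le (hσ i) _ _
        _ ≤ ρ i * (s i * (B * P * T) + s i * (B * P) * (b i / s i / (1 + √(k i)))) := by
          refine mul_le_mul_of_nonneg_left ?_ (ρ i).2
          refine (norm_sub_le_norm_sub_add_norm_sub _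
            (mapBatch (Matrix.toEuclideanLin (A i)) v) _).trans (add_le_add ?_ (hd'.trans hu'))
          exact hlin.trans (mul_le_mul_of_nonneg_left hd (hs i).le)
        _ = _ := by ring

/-- For `t ≥ 1` the rounding loss is absorbed by the summand 1: `⌈(t - 1) ^ 2⌉₊ < (t - 1) ^ 2 + 1 ≤
t ^ 2`. This is what the shrinkage in the sparsification buys. -/
theorem exists_nat_le_one_add_sqrt (t : ℝ) :
    ∃ k : ℕ, t ≤ 1 + √k ∧ (k : ℝ) ≤ t ^ 2 := by
  rcases le_total t 1 with h | h
  · exact ⟨0, by simpa using h, by simpa using sq_nonneg t⟩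
  · refine ⟨⌈(t - 1) ^ 2⌉₊, ?_, ?_⟩
    · have := Real.le_sqrt_of_sq_le (Nat.le_ceil ((t - 1) ^ 2))
      linarith
    · have := Nat.ceil_lt_add_one (sq_nonneg (t - 1))
      nlinarith

theorem exists_network_cover {n : ℕ} (σ : ∀ i : Fin L, E (m i) → E (d i.succ)) (ρ : Fin L → ℝ≥0)
    (hσ : ∀ i, LipschitzWith (ρ i) (σ i)) (hσ0 : ∀ i, σ i 0 = 0)
    (M : ∀ i : Fin L, Matrix (Fin (m i)) (Fin (d i.castSucc)) ℝ) {B : ℝ}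
    {s b : Fin L → ℝ} (hs : ∀ i, 0 < s i) (hb : ∀ i, 0 ≤ b i)
    (X : Batch n (d 0)) (hX : ‖X‖ ≤ B) {N : ℕ} (hN1 : 1 ≤ N)
    (hN : ∀ i, 2 * (m i * d i.castSucc) ≤ N) {ε : ℝ} (hε : 0 < ε) :
    ∃ (K : ℕ) (C : Finset (Batch n (d (Fin.last L)))), C.card ≤ N ^ K ∧
      (K : ℝ) ≤ (B * (∏ i, s i * (ρ i : ℝ)) *
        (∑ i, b i ^ (2 / 3 : ℝ) / s i ^ (2 / 3 : ℝ)) ^ (3 / 2 : ℝ)) ^ 2 / ε ^ 2 ∧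
      ∀ A : ∀ i : Fin L, Matrix (Fin (m i)) (Fin (d i.castSucc)) ℝ,
        (∀ i, specNorm (A i) ≤ s i) → (∀ i, norm21 ((A i)ᵀ - (M i)ᵀ) ≤ b i) →
        ∃ v ∈ C, ‖mapBatch (network σ A) X - v‖ ≤ ε := by
  set P := B * ∏ i, s i * (ρ i : ℝ) with hP
  have hB : 0 ≤ B := (norm_nonneg X).trans hX
  have hP0 : 0 ≤ P := mul_nonneg hB
    (Finset.prod_nonneg fun i _ => mul_nonneg (hs i).le (ρ i).2)
  set u : Fin L → ℝ := fun i => (b i / s i) ^ (1 / 3 : ℝ) with hu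
  have hbs : ∀ i, 0 ≤ b i / s i := fun i => div_nonneg (hb i) (hs i).le
  have hu0 : ∀ i, 0 ≤ u i := fun i => Real.rpow_nonneg (hbs i) _
  have hu3 : ∀ i, b i / s i = u i ^ 3 := fun i => by
    rw [hu, ← Real.rpow_natCast, ← Real.rpow_mul (hbs i)]
    norm_num
  have hu2 : ∀ i, b i ^ (2 / 3 : ℝ) / s i ^ (2 / 3 : ℝ) = u i ^ 2 := fun i => by
    rw [hu, ← Real.div_rpow (hb i) (hs i).le, ← Real.rpow_natCast, ← Real.rpow_mul (hbs i)]
    norm_num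
  simp only [hu2]
  set α := ∑ i, u i ^ 2 with hα
  have hα0 : 0 ≤ α := Finset.sum_nonneg fun i _ => sq_nonneg _
  have hα3 : (α ^ (3 / 2 : ℝ)) ^ 2 = α ^ 3 := by
    rw [← Real.rpow_natCast, ← Real.rpow_natCast, ← Real.rpow_mul hα0]
    norm_num
  -- With `t i` in place of `1 + √(k i)`, minimising `∑ t i ^ 2` under `∑ P * u i ^ 3 / t i = ε`
  -- forces `t i` proportional to `u i`. The constraint gives `t i = P * u i * α / ε`, and then `∑ t
  -- i ^ 2 = P ^ 2 * α ^ 3 / ε ^ 2`.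
  choose k hk1 hk2 using fun i => exists_nat_le_one_add_sqrt
    (P * u i * α / ε)
  obtain ⟨C, hC, -, hcov⟩ := exists_layerOutput_cover σ ρ hσ hσ0 M hs hb X hX k hN1 hN (Fin.last L)
  have hprod : Fin.partialProd (fun i => s i * (ρ i : ℝ)) (Fin.last L) =
      ∏ i, s i * (ρ i : ℝ) := by
    rw [Fin.partialProd, ← List.prod_ofFn, List.take_of_length_le (by simp)]
  have hsumk : Fin.partialSum k (Fin.last L) = ∑ i, k i := by
    rw [Fin.partialSum, ← List.sum_ofFn, List.take_of_length_le (by simp)]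
  have hsum : Fin.partialSum (fun i => b i / s i / (1 + √(k i))) (Fin.last L) =
      ∑ i, b i / s i / (1 + √(k i)) := by
    rw [Fin.partialSum, ← List.sum_ofFn, List.take_of_length_le (by simp)]
  refine ⟨_, C, hC, ?_, fun A hA hAM => ?_⟩
  · rw [hsumk, mul_pow, hα3]
    push_cast
    calc ∑ i, (k i : ℝ) ≤ ∑ i, (P * α / ε) ^ 2 * u i ^ 2 := by
          refine Finset.sum_le_sum fun i _ => (hk2 i).trans (le_of_eq ?_)
          ring
      _ = P ^ 2 * α ^ 3 / ε ^ 2 := by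
          rw [← Finset.mul_sum, ← hα]
          ring
  · obtain ⟨v, hv, hd⟩ := hcov A hA hAM
    refine ⟨v, hv, hd.trans ?_⟩
    rw [hprod, hsum, ← hP, Finset.mul_sum]
    -- If `α = 0`, every `b i` is zero and the cover is exact.
    rcases hα0.eq_or_lt with h0 | hpos
    · have hz : ∀ i, u i = 0 := fun i => by
        have := (Finset.sum_eq_zero_iff_of_nonneg fun i _ => sq_nonneg (u i)).1 h0.symm i
          (Finset.mem_univ i)
        exact pow_eq_zero_iff two_ne_zero |>.1 this
      simp [hu3, hz, hε.le]
    · calc ∑ i, P * (b i / s i / (1 + √(k i))) ≤ ∑ i, ε / α * u i ^ 2 := by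
            refine Finset.sum_le_sum fun i _ => ?_
            have h1 : 0 < 1 + √(k i : ℝ) := by positivity
            have h2 : P * u i ≤ (1 + √(k i : ℝ)) * (ε / α) := by
              have := mul_le_mul_of_nonneg_right (hk1 i) (div_pos hε hpos).le
              refine le_of_eq_of_le ?_ this
              field_simp
            rw [hu3, ← mul_div_assoc, div_le_iff₀ h1]
            have := mul_le_mul_of_nonneg_right h2 (sq_nonneg (u i))
            nlinarith
        _ = ε := by
            rw [← Finset.mul_sum, ← hα]
            field_simp

end Network

/-! ### Rademacher averages: finite classes and chaining -/

section Rademacher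

variable {ι : Type*} {n : ℕ}

/-- The sign `±1` encoded by a Boolean. -/
def sgn (b : Bool) : ℝ := if b then 1 else -1

theorem sgn_sq (b : Bool) : sgn b ^ 2 = 1 := by cases b <;> simp [sgn]

theorem abs_sgn (b : Bool) : |sgn b| = 1 := by cases b <;> simp [sgn]

/-- The average over uniformly distributed signs. -/
noncomputable def signAvg (F : (Fin n → Bool) → ℝ) : ℝ := (2 ^ n : ℝ)⁻¹ * ∑ ε, F ε

theorem signAvg_mono {F G : (Fin n → Bool) → ℝ} (h : ∀ ε, F ε ≤ G ε) : signAvg F ≤ signAvg G :=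
  mul_le_mul_of_nonneg_left (Finset.sum_le_sum fun ε _ => h ε) (by positivity)

theorem signAvg_add (F G : (Fin n → Bool) → ℝ) :
    signAvg (fun ε => F ε + G ε) = signAvg F + signAvg G := by
  simp only [signAvg, Finset.sum_add_distrib, mul_add]

theorem signAvg_const (c : ℝ) : signAvg (fun _ : Fin n → Bool => c) = c := by
  simp [signAvg]

theorem signAvg_const_mul (c : ℝ) (F : (Fin n → Bool) → ℝ) :
    signAvg (fun ε => c * F ε) = c * signAvg F := by
  simp only [signAvg, ← Finset.mul_sum]
  ring

theorem signAvg_exp (w : Fin n → ℝ) :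
    signAvg (fun ε => Real.exp (∑ i, sgn (ε i) * w i)) = ∏ i, Real.cosh (w i) := by
  have h := Finset.prod_univ_sum (fun _ : Fin n => (Finset.univ : Finset Bool))
    (fun i b => Real.exp (sgn b * w i))
  rw [Fintype.piFinset_univ] at h
  simp only [signAvg, Real.exp_sum, ← h, Real.cosh_eq]
  rw [Finset.prod_div_distrib, Finset.prod_const, Finset.card_univ, Fintype.card_fin,
    div_eq_inv_mul]
  simp [sgn]

/-- The Rademacher average of a family of vectors. -/
noncomputable def rademacher (v : ι → Fin n → ℝ) : ℝ :=
  signAvg fun ε => ⨆ a, ∑ i, sgn (ε i) * v a i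

/-- Cauchy–Schwarz against a sign vector, which has norm `√n`. It handles the residual at the finest
scale of the chaining. -/
theorem rademacher_le_sqrt_mul [Nonempty ι] {w : ι → Fin n → ℝ} {r : ℝ} (hr : 0 ≤ r)
    (hw : ∀ a, ∑ i, w a i ^ 2 ≤ r ^ 2) : rademacher w ≤ √n * r := by
  refine (signAvg_mono fun ε => ?_).trans_eq (signAvg_const (n := n) (√n * r))
  refine ciSup_le fun a => (Real.sum_mul_le_sqrt_mul_sqrt _ _ _).trans ?_
  simp only [sgn_sq, Finset.sum_const, Finset.card_univ, Fintype.card_fin, nsmul_eq_mul, mul_one]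
  exact mul_le_mul_of_nonneg_left (Real.sqrt_le_iff.2 ⟨hr, hw a⟩) (Real.sqrt_nonneg _)

variable [Finite ι] [Nonempty ι]

theorem rademacher_add_le (v w : ι → Fin n → ℝ) :
    rademacher (v + w) ≤ rademacher v + rademacher w := by
  rw [rademacher, rademacher, rademacher, ← signAvg_add]
  refine signAvg_mono fun ε => ciSup_le fun a => ?_
  simp only [Pi.add_apply, mul_add, Finset.sum_add_distrib]
  exact add_le_add (le_ciSup (Set.finite_range fun a => ∑ i, sgn (ε i) * v a i).bddAbove a)
    (le_ciSup (Set.finite_range fun a => ∑ i, sgn (ε i) * w a i).bddAbove a)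

/-- The exponential of the supremum is at most the sum of exponentials over the distinct vectors, so
only the cardinality of the range enters. Each exponential averages to a product of hyperbolic
cosines, bounded by a Gaussian. -/
theorem mul_rademacher_le {w : ι → Fin n → ℝ} {r : ℝ}
    (hw : ∀ a, ∑ i, w a i ^ 2 ≤ r ^ 2) {T : ℝ} (hT : ((Set.range w).ncard : ℝ) ≤ Real.exp T)
    (c : ℝ) : c * rademacher w ≤ T + c ^ 2 * r ^ 2 / 2 := by
  classical
  set C := (Set.finite_range w).toFinset with hC
  have hcard : (C.card : ℝ) ≤ Real.exp T := by
    rwa [hC, ← Set.ncard_eq_toFinset_card (Set.range w)]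
  set u := T + c ^ 2 * r ^ 2 / 2 with hu
  have h1 : signAvg (fun ε : Fin n → Bool => Real.exp (c * ⨆ a, ∑ i, sgn (ε i) * w a i)) ≤
      Real.exp u := by
    calc _ ≤ signAvg (fun ε : Fin n → Bool =>
          ∑ v ∈ C, Real.exp (∑ i, sgn (ε i) * (c * v i))) := by
          refine signAvg_mono fun ε => ?_
          obtain ⟨a, ha⟩ := exists_eq_ciSup_of_finite (f := fun a => ∑ i, sgn (ε i) * w a i)
          have hmem : w a ∈ C := by simp [hC]
          refine le_trans (le_of_eq ?_) (Finset.single_le_sum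
            (f := fun v : Fin n → ℝ => Real.exp (∑ i, sgn (ε i) * (c * v i)))
            (fun _ _ => (Real.exp_pos _).le) hmem)
          rw [← ha, Finset.mul_sum]
          congr 1
          exact Finset.sum_congr rfl fun i _ => by ring
      _ = ∑ v ∈ C, ∏ i, Real.cosh (c * v i) := by
          simp only [← signAvg_exp, signAvg]
          rw [Finset.sum_comm, Finset.mul_sum]
      _ ≤ ∑ v ∈ C, Real.exp (c ^ 2 * r ^ 2 / 2) := by
          refine Finset.sum_le_sum fun v hv => ?_
          obtain ⟨a, rfl⟩ := (Set.finite_range w).mem_toFinset.1 hv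
          refine (Finset.prod_le_prod (fun i _ => (Real.cosh_pos _).le)
            fun i _ => Real.cosh_le_exp_half_sq (c * w a i)).trans ?_
          rw [← Real.exp_sum, Real.exp_le_exp]
          calc ∑ i, (c * w a i) ^ 2 / 2 = c ^ 2 / 2 * ∑ i, w a i ^ 2 := by
                rw [Finset.mul_sum]
                exact Finset.sum_congr rfl fun i _ => by ring
            _ ≤ c ^ 2 / 2 * r ^ 2 := mul_le_mul_of_nonneg_left (hw a) (by positivity)
            _ = _ := by ring
      _ ≤ Real.exp u := by
          rw [Finset.sum_const, nsmul_eq_mul, hu, Real.exp_add]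
          exact mul_le_mul_of_nonneg_right hcard (Real.exp_pos _).le
  have h2 : signAvg (fun ε : Fin n → Bool => Real.exp (-u) *
      Real.exp (c * ⨆ a, ∑ i, sgn (ε i) * w a i)) ≤ 1 := by
    rw [signAvg_const_mul, Real.exp_neg]
    exact inv_mul_le_one_of_le₀ h1 (Real.exp_pos _).le
  -- The inequality `1 + x ≤ exp x`, at `x` equal to the exponent minus `u`, takes the place of
  -- Jensen's inequality.
  have h3 : signAvg (fun ε : Fin n → Bool => (1 - u) +
      c * ⨆ a, ∑ i, sgn (ε i) * w a i) ≤ 1 := by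
    refine (signAvg_mono fun ε => ?_).trans h2
    rw [← Real.exp_add]
    have := Real.add_one_le_exp (-u + c * ⨆ a, ∑ i, sgn (ε i) * w a i)
    linarith
  rw [signAvg_add, signAvg_const, signAvg_const_mul] at h3
  rw [rademacher]
  linarith

/-- Massart's finite class lemma. -/
theorem rademacher_le_of_ncard_le {w : ι → Fin n → ℝ} {r : ℝ} (hr : 0 < r)
    (hw : ∀ a, ∑ i, w a i ^ 2 ≤ r ^ 2) {c : ℝ} (hc : 0 ≤ c)
    (hcard : ((Set.range w).ncard : ℝ) ≤ Real.exp (c ^ 2 / 2)) : rademacher w ≤ r * c := by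
  refine le_of_forall_pos_le_add fun η hη => ?_
  -- The slack `η` makes the exponential parameter `c' / r` positive even when `c = 0`.
  set c' := c + η / r with hc'
  have hc'0 : 0 < c' := by positivity
  have hle : c ^ 2 / 2 ≤ c' ^ 2 / 2 := by
    have : c ≤ c' := by rw [hc']; linarith [div_pos hη hr]
    gcongr
  have h := mul_rademacher_le hw (hcard.trans (Real.exp_le_exp.2 hle)) (c' / r)
  have e : r * c + η = r * c' := by
    rw [hc']
    field_simp
  rw [e]
  have e2 : c' ^ 2 / 2 + (c' / r) ^ 2 * r ^ 2 / 2 = c' / r * (r * c') := by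
    field_simp
    ring
  rw [e2] at h
  exact le_of_mul_le_mul_left h (by positivity)

/-- Chaining for classes whose metric entropy at scale `ε` is at most `q² / ε²`. -/
theorem rademacher_le_of_entropy (hn : 0 < n) {v : ι → Fin n → ℝ}
    (hv : ∀ a, ∑ i, v a i ^ 2 ≤ n) {q : ℝ} (hq : 0 ≤ q)
    (hcov : ∀ ε : ℝ, 0 < ε → ∃ C : Finset (Fin n → ℝ), (C.card : ℝ) ≤ Real.exp (q ^ 2 / ε ^ 2) ∧
      ∀ a, ∃ w ∈ C, ∑ i, (v a i - w i) ^ 2 ≤ ε ^ 2) (N : ℕ) :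
    rademacher v ≤ n / 2 ^ N + N * (6 * q) := by
  classical
  have hn0 : (0 : ℝ) < n := by exact_mod_cast hn
  have hsn : 0 < √(n : ℝ) := Real.sqrt_pos.2 hn0
  have key : ∃ π : ι → Fin n → ℝ,
      ((Set.range π).ncard : ℝ) ≤ Real.exp (q ^ 2 / (√n / 2 ^ N) ^ 2) ∧
      (∀ a, ∑ i, (v a i - π a i) ^ 2 ≤ (√n / 2 ^ N) ^ 2) ∧ rademacher π ≤ N * (6 * q) := by
    induction N with
    | zero =>
      -- At the coarsest scale `√n` the zero vector alone is a cover, and its Rademacher average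
      -- vanishes.
      refine ⟨fun _ _ => 0, ?_, ?_, ?_⟩
      · rw [Set.range_const, Set.ncard_singleton, Nat.cast_one]
        exact Real.one_le_exp (by positivity)
      · simpa [Real.sq_sqrt hn0.le] using hv
      · simp [rademacher, signAvg]
    | succ N ih =>
      obtain ⟨π, hπ1, hπ2, hπ3⟩ := ih
      set ε : ℝ := √n / 2 ^ (N + 1) with hε
      have hε0 : 0 < ε := by positivity
      have hε2 : √n / 2 ^ N = 2 * ε := by
        rw [hε, pow_succ]
        field_simp
      rw [hε2] at hπ1 hπ2
      obtain ⟨C, hC, hC'⟩ := hcov ε hε0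
      choose π' hπ'C hπ' using hC'
      have hcard' : ((Set.range π').ncard : ℝ) ≤ Real.exp (q ^ 2 / ε ^ 2) := by
        refine le_trans ?_ hC
        rw [← Set.ncard_coe_finset C]
        exact_mod_cast Set.ncard_le_ncard (by rintro _ ⟨a, rfl⟩; exact hπ'C a) C.finite_toSet
      refine ⟨π', hcard', hπ', ?_⟩
      have hsub : Set.range (π' - π) ⊆ Set.image2 (· - ·) (Set.range π') (Set.range π) := by
        rintro _ ⟨a, rfl⟩
        exact ⟨π' a, ⟨a, rfl⟩, π a, ⟨a, rfl⟩, rfl⟩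
      -- The log-number of links between scales `2 * ε` and `ε` is at most `(1 + 1 / 4) * q ^ 2 / ε
      -- ^ 2`, rounded up to `2 * q ^ 2 / ε ^ 2`. Links have norm at most `3 * ε`, so Massart's
      -- lemma yields `3 * ε * (2 * q / ε) = 6 * q` at every scale.
      have hdiff : ((Set.range (π' - π)).ncard : ℝ) ≤ Real.exp ((2 * q / ε) ^ 2 / 2) := by
        have h1 : (Set.range (π' - π)).ncard ≤ (Set.range π').ncard * (Set.range π).ncard := by
          refine (Set.ncard_le_ncard hsub
            ((Set.finite_range _).image2 _ (Set.finite_range _))).trans ?_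
          rw [← Set.image_prod, ← Set.ncard_prod]
          exact Set.ncard_image_le ((Set.finite_range _).prod (Set.finite_range _))
        calc ((Set.range (π' - π)).ncard : ℝ)
            ≤ (Set.range π').ncard * (Set.range π).ncard := by exact_mod_cast h1
          _ ≤ Real.exp (q ^ 2 / ε ^ 2) * Real.exp (q ^ 2 / (2 * ε) ^ 2) :=
            mul_le_mul hcard' hπ1 (Nat.cast_nonneg _) (Real.exp_pos _).le
          _ ≤ _ := by
            rw [← Real.exp_add, Real.exp_le_exp]
            have : 0 ≤ q ^ 2 / ε ^ 2 := by positivity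
            have e1 : q ^ 2 / (2 * ε) ^ 2 = (q ^ 2 / ε ^ 2) / 4 := by
              field_simp
              ring
            have e2 : (2 * q / ε) ^ 2 / 2 = 2 * (q ^ 2 / ε ^ 2) := by
              field_simp
            rw [e1, e2]
            linarith
      have hnorm : ∀ a, ∑ i, (π' - π) a i ^ 2 ≤ (3 * ε) ^ 2 := by
        intro a
        have key : ‖WithLp.toLp 2 (π' a - π a)‖ ≤ 3 * ε := by
          have h1 : ‖WithLp.toLp 2 (v a - π' a)‖ ≤ ε := by
            refine abs_le_of_sq_le_sq' ?_ hε0.le |>.2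
            simpa [EuclideanSpace.norm_sq_eq] using hπ' a
          have h2 : ‖WithLp.toLp 2 (v a - π a)‖ ≤ 2 * ε := by
            refine abs_le_of_sq_le_sq' ?_ (by positivity) |>.2
            simpa [EuclideanSpace.norm_sq_eq] using hπ2 a
          have e : WithLp.toLp 2 (π' a - π a) =
              WithLp.toLp 2 (v a - π a) - WithLp.toLp 2 (v a - π' a) := by
            rw [← WithLp.toLp_sub]
            congr 1
            abel
          rw [e]
          exact (norm_sub_le _ _).trans (by linarith)
        have := pow_le_pow_left₀ (norm_nonneg _) key 2
        simpa [EuclideanSpace.norm_sq_eq] using this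
      have hM := rademacher_le_of_ncard_le (by positivity) hnorm (by positivity) hdiff
      have e3 : 3 * ε * (2 * q / ε) = 6 * q := by
        field_simp
        ring
      have := rademacher_add_le (π' - π) π
      rw [sub_add_cancel] at this
      push_cast
      linarith
  obtain ⟨π, -, hπ2, hπ3⟩ := key
  have h1 := rademacher_add_le (v - π) π
  rw [sub_add_cancel] at h1
  have h2 := rademacher_le_sqrt_mul (w := v - π) (r := √n / 2 ^ N) (by positivity) hπ2
  have e : √(n : ℝ) * (√n / 2 ^ N) = n / 2 ^ N := by
    rw [← mul_div_assoc, Real.mul_self_sqrt hn0.le]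
  linarith

end Rademacher

/-! ### McDiarmid's inequality -/

section Concentration

open ProbabilityTheory

variable {Z : Type*} [MeasurableSpace Z] (μ : Measure Z) [IsProbabilityMeasure μ]

theorem integrable_of_abs_le {Ω : Type*} [MeasurableSpace Ω] {ν : Measure Ω} [IsFiniteMeasure ν]
    {f : Ω → ℝ} (hf : Measurable f) {K : ℝ} (hK : ∀ z, |f z| ≤ K) : Integrable f ν :=
  Integrable.of_bound hf.aestronglyMeasurable K (Filter.Eventually.of_forall hK)

theorem piFinSuccAbove_zero_symm_apply {n : ℕ} (p : Z × (Fin n → Z)) :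
    (MeasurableEquiv.piFinSuccAbove (fun _ : Fin (n + 1) => Z) 0).symm p = Fin.cons p.1 p.2 :=
  Fin.insertNth_zero' p.1 p.2

theorem integral_pi_succ {n : ℕ} (f : (Fin (n + 1) → Z) → ℝ)
    (hf : Integrable f (Measure.pi fun _ => μ)) :
    ∫ z, f z ∂(Measure.pi fun _ : Fin (n + 1) => μ) =
      ∫ x, ∫ y, f (Fin.cons x y) ∂(Measure.pi fun _ : Fin n => μ) ∂μ := by
  have hmp := (measurePreserving_piFinSuccAbove (fun _ : Fin (n + 1) => μ) 0).symm
  rw [← hmp.integral_comp']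
  rw [integral_prod]
  · simp only [piFinSuccAbove_zero_symm_apply]
  · exact hmp.integrable_comp_of_integrable hf

/-- The moment generating function bound behind McDiarmid's inequality. -/
theorem integral_exp_le_of_bounded_differences {n : ℕ} (f : (Fin n → Z) → ℝ) (hf : Measurable f)
    {K : ℝ} (hK : ∀ z, |f z| ≤ K) {c : ℝ} (hc : 0 ≤ c)
    (hdiff : ∀ i z w, f (Function.update z i w) ≤ f z + c) (t : ℝ) :
    ∫ z, Real.exp (t * (f z - ∫ z, f z ∂(Measure.pi fun _ : Fin n => μ)))
      ∂(Measure.pi fun _ : Fin n => μ) ≤ Real.exp (n * (c ^ 2 / 4) * t ^ 2 / 2) := by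
  induction n with
  | zero =>
    have h0 : ∀ z : Fin 0 → Z, f z = f Fin.elim0 := fun z => congrArg f (Subsingleton.elim _ _)
    simp only [h0]
    simp
  | succ n ih =>
    set ν := Measure.pi fun _ : Fin n => μ with hν
    set m := ∫ z, f z ∂(Measure.pi fun _ : Fin (n + 1) => μ) with hm
    have hcons : Measurable fun p : Z × (Fin n → Z) => (Fin.cons p.1 p.2 : Fin (n + 1) → Z) := by
      simp only [← piFinSuccAbove_zero_symm_apply]
      exact (MeasurableEquiv.piFinSuccAbove (fun _ : Fin (n + 1) => Z) 0).symm.measurable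
    have hF : Measurable fun p : Z × (Fin n → Z) => f (Fin.cons p.1 p.2) := hf.comp hcons
    -- The mean of `f` given the first coordinate stays in an interval of length `c`, so Hoeffding's
    -- lemma gives it variance proxy `c ^ 2 / 4`. The fluctuation around it, for fixed first
    -- coordinate, is left to the induction hypothesis.
    set g : Z → ℝ := fun x => ∫ y, f (Fin.cons x y) ∂ν with hg
    have hgm : Measurable g := hF.stronglyMeasurable.integral_prod_right.measurable
    have hsec : ∀ x, Measurable fun y : Fin n → Z => f (Fin.cons x y) := fun x =>
      hF.comp measurable_prodMk_left
    have hint : ∀ x, Integrable (fun y : Fin n → Z => f (Fin.cons x y)) ν := fun x =>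
      integrable_of_abs_le (hsec x) fun _ => hK _
    have hgdiff : ∀ x x', g x' ≤ g x + c := by
      intro x x'
      have : g x + c = ∫ y, (f (Fin.cons x y) + c) ∂ν := by
        rw [integral_add (hint x) (integrable_const c)]
        simp [hg]
      rw [this]
      refine integral_mono (hint x') ((hint x).add (integrable_const c)) fun y => ?_
      have := hdiff 0 (Fin.cons x y) x'
      rwa [Fin.update_cons_zero] at this
    have hgK : ∀ x, |g x| ≤ K := fun x => by
      have := norm_integral_le_of_norm_le_const (μ := ν) (f := fun y => f (Fin.cons x y))
        (C := K) (Filter.Eventually.of_forall fun _ => hK _)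
      simpa using this
    have hbdd : BddBelow (Set.range g) := ⟨-K, by
      rintro _ ⟨x, rfl⟩
      exact (abs_le.1 (hgK x)).1⟩
    have hne : Nonempty Z := μ.nonempty_of_neZero
    have hmg : m = ∫ x, g x ∂μ := integral_pi_succ μ f (integrable_of_abs_le hf hK)
    have hIcc : ∀ x, g x ∈ Set.Icc (⨅ x, g x) ((⨅ x, g x) + c) := fun x =>
      ⟨ciInf_le hbdd x, by
        have : g x - c ≤ ⨅ x, g x := le_ciInf fun x' => by linarith [hgdiff x' x]
        linarith⟩
    have hsub := (hasSubgaussianMGF_of_mem_Icc (μ := μ) hgm.aemeasurable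
      (Filter.Eventually.of_forall hIcc)).mgf_le t
    have hcc : (((‖(⨅ x, g x) + c - ⨅ x, g x‖₊ / 2) ^ 2 : ℝ≥0) : ℝ) = c ^ 2 / 4 := by
      rw [add_sub_cancel_left]
      push_cast
      rw [Real.norm_of_nonneg hc]
      ring
    rw [hcc, mgf] at hsub
    have hEint : Integrable (fun z => Real.exp (t * (f z - m)))
        (Measure.pi fun _ : Fin (n + 1) => μ) := by
      refine integrable_of_abs_le (K := Real.exp (|t| * (K + |m|))) (by fun_prop) fun z => ?_
      rw [abs_of_pos (Real.exp_pos _), Real.exp_le_exp]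
      refine (le_abs_self _).trans ?_
      rw [abs_mul]
      refine mul_le_mul_of_nonneg_left ((abs_sub _ _).trans ?_) (abs_nonneg _)
      linarith [hK z]
    rw [integral_pi_succ μ _ hEint]
    have hin : ∀ x, ∫ y, Real.exp (t * (f (Fin.cons x y) - m)) ∂ν ≤
        Real.exp (t * (g x - ∫ x, g x ∂μ)) * Real.exp (n * (c ^ 2 / 4) * t ^ 2 / 2) := by
      intro x
      have h := ih (fun y => f (Fin.cons x y)) (hsec x) (fun _ => hK _) (fun i y w => by
        have := hdiff i.succ (Fin.cons x y) w
        rwa [← Fin.cons_update] at this)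
      refine le_of_eq_of_le ?_ (mul_le_mul_of_nonneg_left h (Real.exp_pos _).le)
      rw [← integral_const_mul]
      refine integral_congr_ae (Filter.Eventually.of_forall fun y => ?_)
      simp only
      rw [← Real.exp_add, hmg]
      congr 1
      simp only [hg]
      ring
    have hgint : Integrable (fun x => Real.exp (t * (g x - ∫ x, g x ∂μ))) μ := by
      rw [← hmg]
      refine integrable_of_abs_le (K := Real.exp (|t| * (K + |m|))) (by fun_prop) fun z => ?_
      rw [abs_of_pos (Real.exp_pos _), Real.exp_le_exp]
      refine (le_abs_self _).trans ?_
      rw [abs_mul]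
      refine mul_le_mul_of_nonneg_left ((abs_sub _ _).trans ?_) (abs_nonneg _)
      linarith [hgK z]
    calc _ ≤ ∫ x, Real.exp (t * (g x - ∫ x, g x ∂μ)) *
          Real.exp (n * (c ^ 2 / 4) * t ^ 2 / 2) ∂μ :=
          integral_mono_of_nonneg
            (Filter.Eventually.of_forall fun x => integral_nonneg fun y => (Real.exp_pos _).le)
            (hgint.mul_const _) (Filter.Eventually.of_forall hin)
      _ = (∫ x, Real.exp (t * (g x - ∫ x, g x ∂μ)) ∂μ) *
          Real.exp (n * (c ^ 2 / 4) * t ^ 2 / 2) := integral_mul_const _ _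
      _ ≤ Real.exp (c ^ 2 / 4 * t ^ 2 / 2) * Real.exp (n * (c ^ 2 / 4) * t ^ 2 / 2) :=
          mul_le_mul_of_nonneg_right hsub (Real.exp_pos _).le
      _ = _ := by
          rw [← Real.exp_add]
          congr 1
          push_cast
          ring

/-- McDiarmid's inequality. -/
theorem measureReal_ge_le_of_bounded_differences {n : ℕ} (f : (Fin n → Z) → ℝ) (hf : Measurable f)
    {K : ℝ} (hK : ∀ z, |f z| ≤ K) {c : ℝ} (hc : 0 ≤ c)
    (hdiff : ∀ i z w, f (Function.update z i w) ≤ f z + c) {u : ℝ} (hu : 0 ≤ u) :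
    (Measure.pi fun _ : Fin n => μ).real
      {z | u ≤ f z - ∫ z, f z ∂(Measure.pi fun _ : Fin n => μ)} ≤
      Real.exp (-u ^ 2 / (2 * (n * (c ^ 2 / 4)))) := by
  set m := ∫ z, f z ∂(Measure.pi fun _ : Fin n => μ) with hm
  have h : HasSubgaussianMGF (fun z => f z - m) ⟨n * (c ^ 2 / 4), by positivity⟩
      (Measure.pi fun _ : Fin n => μ) := by
    refine ⟨fun t => ?_, fun t => ?_⟩
    · refine integrable_of_abs_le (K := Real.exp (|t| * (K + |m|))) (by fun_prop) fun z => ?_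
      rw [abs_of_pos (Real.exp_pos _), Real.exp_le_exp]
      refine (le_abs_self _).trans ?_
      rw [abs_mul]
      refine mul_le_mul_of_nonneg_left ((abs_sub _ _).trans ?_) (abs_nonneg _)
      linarith [hK z]
    · exact integral_exp_le_of_bounded_differences μ f hf hK hc hdiff t
  exact h.measure_ge_le hu

end Concentration

/-! ### Symmetrization and uniform deviations -/

section Generalization

variable {ι : Type*}

theorem abs_ciSup_le_of_forall [Finite ι] [Nonempty ι] {g : ι → ℝ} {K : ℝ}
    (h : ∀ a, |g a| ≤ K) : |⨆ a, g a| ≤ K := by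
  obtain ⟨a, ha⟩ := exists_eq_ciSup_of_finite (f := g)
  rw [← ha]
  exact h a

theorem ciSup_le_ciSup_add [Finite ι] [Nonempty ι] {g h : ι → ℝ} {K : ℝ} (H : ∀ a, g a ≤ h a + K) :
    ⨆ a, g a ≤ (⨆ a, h a) + K :=
  ciSup_le fun a => (H a).trans
    (add_le_add_left (le_ciSup (Set.finite_range h).bddAbove a) K)

theorem abs_sum_update_sub_le {Z : Type*} {n : ℕ} {h : Fin n → Z → ℝ} {K : ℝ}
    (hh : ∀ j x y, |h j x - h j y| ≤ K) (z : Fin n → Z) (i : Fin n) (w : Z) :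
    |∑ j, h j (Function.update z i w j) - ∑ j, h j (z j)| ≤ K := by
  rw [← Finset.sum_sub_distrib, Finset.sum_eq_single i]
  · exact hh _ _ _
  · intro j _ hj
    rw [Function.update_of_ne hj, sub_self]
  · simp

variable {Z : Type*} {n : ℕ}

/-- The supremum over a class of the signed sums over a sample. -/
noncomputable def signedSup (f : ι → Z → ℝ) (ε : Fin n → Bool) (z : Fin n → Z) : ℝ :=
  ⨆ a, ∑ i, sgn (ε i) * f a (z i)

variable {f : ι → Z → ℝ}

theorem abs_sum_le_card {g : Fin n → ℝ} (h : ∀ i, |g i| ≤ 1) : |∑ i, g i| ≤ n := by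
  refine (Finset.abs_sum_le_sum_abs _ _).trans ((Finset.sum_le_sum fun i _ => h i).trans ?_)
  simp

theorem abs_sub_le_one_of_mem_Icc {x y : ℝ} (hx : x ∈ Set.Icc (0 : ℝ) 1)
    (hy : y ∈ Set.Icc (0 : ℝ) 1) : |x - y| ≤ 1 :=
  abs_le.2 ⟨by linarith [hx.1, hy.2], by linarith [hx.2, hy.1]⟩

theorem abs_signedSup_le [Finite ι] [Nonempty ι] (h01 : ∀ a x, f a x ∈ Set.Icc (0 : ℝ) 1)
    (ε : Fin n → Bool) (z : Fin n → Z) : |signedSup f ε z| ≤ n :=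
  abs_ciSup_le_of_forall fun a => abs_sum_le_card fun i => by
    rw [abs_mul, abs_sgn, one_mul, abs_of_nonneg (h01 a _).1]
    exact (h01 a _).2

theorem signedSup_update_le [Finite ι] [Nonempty ι] (h01 : ∀ a x, f a x ∈ Set.Icc (0 : ℝ) 1)
    (ε : Fin n → Bool) (z : Fin n → Z) (i : Fin n) (w : Z) :
    signedSup f ε z ≤ signedSup f ε (Function.update z i w) + 1 :=
  ciSup_le_ciSup_add fun a => by
    have := abs_sum_update_sub_le (h := fun j x => sgn (ε j) * f a x) (K := 1) (fun j x y => by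
      rw [← mul_sub, abs_mul, abs_sgn, one_mul]
      exact abs_sub_le_one_of_mem_Icc (h01 a x) (h01 a y)) z i w
    linarith [(abs_le.1 this).1]

variable [MeasurableSpace Z] (μ : Measure Z)

/-- The largest excess over a class of the expected sum over the sum on the sample. -/
noncomputable def maxDeviation (f : ι → Z → ℝ) (z : Fin n → Z) : ℝ :=
  ⨆ a, ∑ i, (∫ x, f a x ∂μ - f a (z i))

theorem measurable_signedSup [Finite ι] (hf : ∀ a, Measurable (f a)) (ε : Fin n → Bool) :
    Measurable (signedSup f ε) :=
  Measurable.iSup fun a => Finset.measurable_sum _ fun i _ =>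
    ((hf a).comp (measurable_pi_apply i)).const_mul _

theorem measurable_maxDeviation [Finite ι] (hf : ∀ a, Measurable (f a)) :
    Measurable (maxDeviation (n := n) μ f) :=
  Measurable.iSup fun a => Finset.measurable_sum _ fun i _ =>
    ((hf a).comp (measurable_pi_apply i)).const_sub _

theorem integral_mem_Icc [IsProbabilityMeasure μ] (hf : ∀ a, Measurable (f a))
    (h01 : ∀ a x, f a x ∈ Set.Icc (0 : ℝ) 1) (a : ι) : ∫ x, f a x ∂μ ∈ Set.Icc (0 : ℝ) 1 := by
  refine ⟨integral_nonneg fun x => (h01 a x).1, ?_⟩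
  have hint : Integrable (f a) μ := integrable_of_abs_le (hf a) (K := 1) fun x => by
    rw [abs_of_nonneg (h01 a x).1]
    exact (h01 a x).2
  have := integral_mono hint (integrable_const 1) fun x => (h01 a x).2
  simpa using this

variable [Finite ι] [Nonempty ι]

theorem maxDeviation_update_le (h01 : ∀ a x, f a x ∈ Set.Icc (0 : ℝ) 1)
    (z : Fin n → Z) (i : Fin n) (w : Z) :
    maxDeviation μ f (Function.update z i w) ≤ maxDeviation μ f z + 1 :=
  ciSup_le_ciSup_add fun a => by
    have := abs_sum_update_sub_le (h := fun _ x => ∫ x, f a x ∂μ - f a x) (K := 1) (fun j x y => by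
      rw [sub_sub_sub_cancel_left]
      exact abs_sub_le_one_of_mem_Icc (h01 a y) (h01 a x)) z i w
    linarith [(abs_le.1 this).2]

variable [IsProbabilityMeasure μ]

theorem abs_maxDeviation_le (hf : ∀ a, Measurable (f a))
    (h01 : ∀ a x, f a x ∈ Set.Icc (0 : ℝ) 1) (z : Fin n → Z) : |maxDeviation μ f z| ≤ n :=
  abs_ciSup_le_of_forall fun a => abs_sum_le_card fun _ =>
    abs_sub_le_one_of_mem_Icc (integral_mem_Icc μ hf h01 a) (h01 a _)

/-- The expectation is written as an average over an independent ghost sample, and a supremum of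
integrals is at most the integral of the supremum. -/
theorem maxDeviation_le_integral (hf : ∀ a, Measurable (f a))
    (h01 : ∀ a x, f a x ∈ Set.Icc (0 : ℝ) 1) (z : Fin n → Z) :
    maxDeviation μ f z ≤
      ∫ z', (⨆ a, ∑ i, (f a (z' i) - f a (z i))) ∂(Measure.pi fun _ : Fin n => μ) := by
  have hm : ∀ a i, Measurable fun z' : Fin n → Z => f a (z' i) - f a (z i) := fun a i =>
    ((hf a).comp (measurable_pi_apply i)).sub_const _
  have hb : ∀ a i (z' : Fin n → Z), |f a (z' i) - f a (z i)| ≤ 1 := fun a i z' =>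
    abs_sub_le_one_of_mem_Icc (h01 a _) (h01 a _)
  have hint : Integrable (fun z' : Fin n → Z => ⨆ a, ∑ i, (f a (z' i) - f a (z i)))
      (Measure.pi fun _ : Fin n => μ) :=
    integrable_of_abs_le (K := n) (Measurable.iSup fun a => Finset.measurable_sum _ fun i _ => hm a i)
      fun z' => abs_ciSup_le_of_forall fun a => abs_sum_le_card fun i => hb a i z'
  refine ciSup_le fun a => ?_
  have hint1 : ∀ i, Integrable (fun z' : Fin n → Z => f a (z' i) - f a (z i))
      (Measure.pi fun _ : Fin n => μ) := fun i => integrable_of_abs_le (hm a i) (hb a i)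
  have hint2 : ∀ i, Integrable (fun z' : Fin n → Z => f a (z' i))
      (Measure.pi fun _ : Fin n => μ) := fun i =>
    integrable_of_abs_le (K := 1) ((hf a).comp (measurable_pi_apply i)) fun z' => by
      rw [abs_of_nonneg (h01 a _).1]
      exact (h01 a _).2
  have e : ∑ i, (∫ x, f a x ∂μ - f a (z i)) =
      ∫ z', ∑ i, (f a (z' i) - f a (z i)) ∂(Measure.pi fun _ : Fin n => μ) := by
    rw [integral_finsetSum _ fun i _ => hint1 i]
    refine Finset.sum_congr rfl fun i _ => ?_
    rw [integral_sub (hint2 i) (integrable_const _)]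
    have := integral_comp_eval (μ := fun _ : Fin n => μ) (i := i) (f := f a)
      (hf a).aestronglyMeasurable
    simp [this]
  rw [e]
  refine integral_mono (integrable_finsetSum _ fun i _ => hint1 i) hint fun z' => ?_
  exact le_ciSup (f := fun a => ∑ i, (f a (z' i) - f a (z i))) (Set.finite_range _).bddAbove a

/-- Exchange the two members of the pairs at the positions where the sign is negative. -/
theorem measurePreserving_swapSigns (ε : Fin n → Bool) :
    MeasurePreserving (fun (w : Fin n → Z × Z) i => if ε i then w i else (w i).swap)
      (Measure.pi fun _ => μ.prod μ) (Measure.pi fun _ => μ.prod μ) := by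
  refine measurePreserving_pi (fun _ : Fin n => μ.prod μ) (fun _ : Fin n => μ.prod μ)
    (f := fun i p => if ε i then p else p.swap) fun i => ?_
  cases ε i
  · simpa using Measure.measurePreserving_swap (μ := μ) (ν := μ)
  · exact MeasurePreserving.id (μ.prod μ)

/-- Swapping sample and ghost sample where `ε` is negative preserves the product measure and
attaches the signs `ε` to the differences. The supremum then splits into a part for the ghost sample
and one for the sample, the latter with opposite signs. -/
theorem integral_maxDeviation_le_signedSup (hf : ∀ a, Measurable (f a))
    (h01 : ∀ a x, f a x ∈ Set.Icc (0 : ℝ) 1) (ε : Fin n → Bool) :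
    ∫ z, maxDeviation μ f z ∂(Measure.pi fun _ : Fin n => μ) ≤
      ∫ z, signedSup f ε z ∂(Measure.pi fun _ : Fin n => μ) +
      ∫ z, signedSup f (fun i => !ε i) z ∂(Measure.pi fun _ : Fin n => μ) := by
  set ν := Measure.pi fun _ : Fin n => μ with hν
  set G : (Fin n → Z) × (Fin n → Z) → ℝ := fun p => ⨆ a, ∑ i, (f a (p.2 i) - f a (p.1 i)) with hG
  have hGm : Measurable G := Measurable.iSup fun a => Finset.measurable_sum _ fun i _ =>
    ((hf a).comp ((measurable_pi_apply i).comp measurable_snd)).sub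
      ((hf a).comp ((measurable_pi_apply i).comp measurable_fst))
  have hGb : ∀ p, |G p| ≤ n := fun p => abs_ciSup_le_of_forall fun a => abs_sum_le_card fun i =>
    abs_sub_le_one_of_mem_Icc (h01 a _) (h01 a _)
  have hGint : Integrable G (ν.prod ν) := integrable_of_abs_le hGm hGb
  have h1 : ∫ z, maxDeviation μ f z ∂ν ≤ ∫ p, G p ∂(ν.prod ν) := by
    rw [integral_prod _ hGint]
    exact integral_mono (integrable_of_abs_le (measurable_maxDeviation μ hf)
      (abs_maxDeviation_le μ hf h01)) hGint.integral_prod_left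
      fun z => maxDeviation_le_integral μ hf h01 z
  set P := Measure.pi fun _ : Fin n => μ.prod μ with hP
  have hmp := measurePreserving_arrowProdEquivProdArrow Z Z (Fin n) (fun _ => μ) (fun _ => μ)
  have hcomp := hmp.comp (measurePreserving_swapSigns μ ε)
  have hfst : MeasurePreserving (fun (w : Fin n → Z × Z) i => (w i).1) P ν :=
    measurePreserving_pi (fun _ : Fin n => μ.prod μ) (fun _ : Fin n => μ)
      (f := fun _ => Prod.fst) fun _ => measurePreserving_fst
  have hsnd : MeasurePreserving (fun (w : Fin n → Z × Z) i => (w i).2) P ν :=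
    measurePreserving_pi (fun _ : Fin n => μ.prod μ) (fun _ : Fin n => μ)
      (f := fun _ => Prod.snd) fun _ => measurePreserving_snd
  have hS : ∀ ε : Fin n → Bool, Integrable (signedSup f ε) ν := fun ε =>
    integrable_of_abs_le (measurable_signedSup hf ε) (abs_signedSup_le h01 ε)
  have e1 : ∫ p, G p ∂(ν.prod ν) = ∫ w, G (MeasurableEquiv.arrowProdEquivProdArrow Z Z (Fin n)
      (fun i => if ε i then w i else (w i).swap)) ∂P := by
    have := integral_map (μ := P) hcomp.measurable.aemeasurable
      (f := G) hGm.aestronglyMeasurable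
    rw [hcomp.map_eq] at this
    exact this
  have e2 : ∫ z, signedSup f ε z ∂ν = ∫ w, signedSup f ε (fun i => (w i).2) ∂P := by
    have := integral_map (μ := P) hsnd.measurable.aemeasurable
      (f := signedSup f ε) (measurable_signedSup hf ε).aestronglyMeasurable
    rw [hsnd.map_eq] at this
    exact this
  have e3 : ∫ z, signedSup f (fun i => !ε i) z ∂ν =
      ∫ w, signedSup f (fun i => !ε i) (fun i => (w i).1) ∂P := by
    have := integral_map (μ := P) hfst.measurable.aemeasurable
      (f := signedSup f fun i => !ε i) (measurable_signedSup hf _).aestronglyMeasurable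
    rw [hfst.map_eq] at this
    exact this
  have i2 : Integrable (fun w : Fin n → Z × Z => signedSup f ε fun i => (w i).2) P :=
    hsnd.integrable_comp_of_integrable (hS ε)
  have i3 : Integrable (fun w : Fin n → Z × Z => signedSup f (fun i => !ε i) fun i => (w i).1) P :=
    hfst.integrable_comp_of_integrable (hS _)
  refine h1.trans ?_
  rw [e1, e2, e3, ← integral_add i2 i3]
  refine integral_mono (hcomp.integrable_comp_of_integrable hGint) (i2.add i3) fun w => ?_
  refine ciSup_le fun a => ?_
  have l2 := le_ciSup (f := fun a => ∑ i, sgn (ε i) * f a (w i).2) (Set.finite_range _).bddAbove a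
  have l3 := le_ciSup (f := fun a => ∑ i, sgn (!ε i) * f a (w i).1) (Set.finite_range _).bddAbove a
  refine le_trans (le_of_eq ?_) (add_le_add l2 l3)
  rw [← Finset.sum_add_distrib]
  refine Finset.sum_congr rfl fun i _ => ?_
  simp only [MeasurableEquiv.arrowProdEquivProdArrow, MeasurableEquiv.coe_mk,
    Equiv.arrowProdEquivProdArrow_apply]
  cases ε i <;> simp [sgn] <;> ring

theorem signAvg_not (F : (Fin n → Bool) → ℝ) :
    signAvg (fun ε => F fun i => !ε i) = signAvg F := by
  have h := Equiv.sum_comp (Equiv.piCongrRight fun _ : Fin n => Equiv.boolNot) F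
  simp only [signAvg, ← h]
  rfl

/-- Symmetrization. -/
theorem integral_maxDeviation_le (hf : ∀ a, Measurable (f a))
    (h01 : ∀ a x, f a x ∈ Set.Icc (0 : ℝ) 1) :
    ∫ z, maxDeviation μ f z ∂(Measure.pi fun _ : Fin n => μ) ≤
      2 * ∫ z, rademacher (fun a i => f a (z i)) ∂(Measure.pi fun _ : Fin n => μ) := by
  have hS : ∀ ε : Fin n → Bool, Integrable (signedSup f ε) (Measure.pi fun _ : Fin n => μ) :=
    fun ε => integrable_of_abs_le (measurable_signedSup hf ε) (abs_signedSup_le h01 ε)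
  have e : ∫ z, rademacher (fun a i => f a (z i)) ∂(Measure.pi fun _ : Fin n => μ) =
      signAvg fun ε => ∫ z, signedSup f ε z ∂(Measure.pi fun _ : Fin n => μ) := by
    change ∫ z, (2 ^ n : ℝ)⁻¹ * ∑ ε, signedSup f ε z ∂(Measure.pi fun _ : Fin n => μ) = _
    rw [integral_const_mul, integral_finsetSum _ fun ε _ => hS ε]
    rfl
  rw [← signAvg_const (n := n) (∫ z, maxDeviation μ f z ∂(Measure.pi fun _ : Fin n => μ)), e]
  refine (signAvg_mono fun ε => integral_maxDeviation_le_signedSup μ hf h01 ε).trans_eq ?_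
  rw [signAvg_add, two_mul]
  congr 1
  exact signAvg_not fun ε => ∫ z, signedSup f ε z ∂(Measure.pi fun _ : Fin n => μ)

/-- The uniform deviation bound with the empirical Rademacher average. -/
theorem measureReal_maxDeviation_gt_le (hn : 0 < n) (hf : ∀ a, Measurable (f a))
    (h01 : ∀ a x, f a x ∈ Set.Icc (0 : ℝ) 1) {δ : ℝ} (hδ : 0 < δ) (hδ1 : δ ≤ 1) :
    (Measure.pi fun _ : Fin n => μ).real
      {z | 2 * rademacher (fun a i => f a (z i)) + n * (3 * √(Real.log (1 / δ) / (2 * n))) ≤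
        maxDeviation μ f z} ≤ δ := by
  have hn0 : (0 : ℝ) < n := by exact_mod_cast hn
  set R : (Fin n → Z) → ℝ := fun z => rademacher (fun a i => f a (z i)) with hR
  have hRm : Measurable R := by
    have : Measurable fun z => (2 ^ n : ℝ)⁻¹ * ∑ ε : Fin n → Bool, signedSup f ε z :=
      (Finset.measurable_sum _ fun ε _ => measurable_signedSup hf ε).const_mul _
    exact this
  have hRb : ∀ z, |R z| ≤ n := fun z => by
    refine abs_le.2 ⟨?_, ?_⟩
    · rw [← signAvg_const (n := n) (-(n : ℝ))]
      exact signAvg_mono fun ε => (abs_le.1 (abs_signedSup_le h01 ε z)).1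
    · rw [← signAvg_const (n := n) (n : ℝ)]
      exact signAvg_mono fun ε => (abs_le.1 (abs_signedSup_le h01 ε z)).2
  have hRu : ∀ i z w, R z ≤ R (Function.update z i w) + 1 := fun i z w => by
    rw [← signAvg_const (n := n) (1 : ℝ)]
    refine (signAvg_mono fun ε => signedSup_update_le h01 ε z i w).trans_eq (signAvg_add _ _)
  set D : (Fin n → Z) → ℝ := maxDeviation μ f with hD
  have hDm : Measurable D := measurable_maxDeviation μ hf
  have hDb : ∀ z, |D z| ≤ n := abs_maxDeviation_le μ hf h01
  have hint : ∫ z, (D z - 2 * R z) ∂(Measure.pi fun _ : Fin n => μ) ≤ 0 := by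
    rw [integral_sub (integrable_of_abs_le hDm hDb)
      ((integrable_of_abs_le hRm hRb).const_mul 2), integral_const_mul]
    linarith [integral_maxDeviation_le (n := n) μ hf h01]
  have hlog : 0 ≤ Real.log (1 / δ) := Real.log_nonneg (one_le_one_div hδ hδ1)
  -- Replacing one sample point changes `D` and `R` by at most 1 each, hence `D - 2 * R` by at most
  -- 3. This is the factor 3 of the confidence term, and the resulting exponent is exactly `log δ`.
  have hmc := measureReal_ge_le_of_bounded_differences μ (fun z => D z - 2 * R z)
    (hDm.sub (hRm.const_mul 2)) (K := n + 2 * n) (fun z => by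
      refine (abs_sub _ _).trans (add_le_add (hDb z) ?_)
      rw [abs_mul, abs_two]
      exact mul_le_mul_of_nonneg_left (hRb z) zero_le_two) (c := 3) (by norm_num)
    (fun i z w => by linarith [maxDeviation_update_le μ h01 z i w, hRu i z w])
    (u := n * (3 * √(Real.log (1 / δ) / (2 * n)))) (by positivity)
  refine (measureReal_mono fun z hz => ?_).trans (hmc.trans (le_of_eq ?_))
  · have hz' : 2 * R z + n * (3 * √(Real.log (1 / δ) / (2 * n))) ≤ D z := hz
    simp only [Set.mem_ofPred_eq]
    linarith
  · have : -(n * (3 * √(Real.log (1 / δ) / (2 * n)))) ^ 2 / (2 * (n * (3 ^ 2 / 4))) =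
        Real.log δ := by
      rw [mul_pow, mul_pow, Real.sq_sqrt (by positivity), one_div, Real.log_inv]
      field_simp
      ring
    rw [this, Real.exp_log hδ]

end Generalization

/-- Uniform deviation bound for a separable class: on the samples in `G`, where the Rademacher
averages of all finite subclasses are at most `β`, the deviations exceed `2 * β` by more than the
confidence term with probability at most `δ`. -/
theorem measure_exists_deviation_gt_le {Θ Z : Type*} [TopologicalSpace Θ]
    [SecondCountableTopology Θ] [MeasurableSpace Z] (μ : Measure Z) [IsProbabilityMeasure μ]
    {n : ℕ} (hn : 0 < n) {f : Θ → Z → ℝ} (hf : ∀ θ, Measurable (f θ))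
    (hcont : ∀ x, Continuous fun θ => f θ x) (h01 : ∀ θ x, f θ x ∈ Set.Icc (0 : ℝ) 1)
    {δ : ℝ} (hδ : 0 < δ) (hδ1 : δ ≤ 1) {G : Set (Fin n → Z)} {β : ℝ}
    (hβ : ∀ z ∈ G, ∀ (N : ℕ) (g : Fin (N + 1) → Θ),
      rademacher (fun a i => f (g a) (z i)) ≤ β) :
    (Measure.pi fun _ : Fin n => μ) {z | z ∈ G ∧ ∃ θ,
      2 * β + n * (3 * √(Real.log (1 / δ) / (2 * n))) < ∑ i, (∫ x, f θ x ∂μ - f θ (z i))} ≤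
      ENNReal.ofReal δ := by
  rcases isEmpty_or_nonempty Θ with hΘ | hΘ
  · simp
  set τ := n * (3 * √(Real.log (1 / δ) / (2 * n))) with hτ
  set u := TopologicalSpace.denseSeq Θ
  set D : Θ → (Fin n → Z) → ℝ := fun θ z => ∑ i, (∫ x, f θ x ∂μ - f θ (z i)) with hD
  have hDcont : ∀ z, Continuous fun θ => D θ z := by
    intro z
    refine continuous_finsetSum _ fun i _ => Continuous.sub ?_ (hcont _)
    refine continuous_of_dominated (bound := fun _ => 1)
      (fun θ => (hf θ).aestronglyMeasurable) (fun θ => Filter.Eventually.of_forall fun x => ?_)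
      (integrable_const _) (Filter.Eventually.of_forall hcont)
    rw [Real.norm_of_nonneg (h01 θ x).1]
    exact (h01 θ x).2
  set S : ℕ → Set (Fin n → Z) := fun N => {z | z ∈ G ∧ ∃ j : Fin (N + 1), 2 * β + τ < D (u j) z}
    with hS
  have hmono : Monotone S := by
    rintro N N' h z ⟨hz, j, hj⟩
    exact ⟨hz, Fin.castLE (by omega) j, hj⟩
  have hsub : {z | z ∈ G ∧ ∃ θ, 2 * β + τ < D θ z} ⊆ ⋃ N, S N := by
    rintro z ⟨hz, θ, hθ⟩
    -- The strict inequality defines an open set of parameters, so a violation anywhere is also a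
    -- violation at some member of the dense sequence.
    obtain ⟨j, hj⟩ := (TopologicalSpace.denseRange_denseSeq Θ).exists_mem_open
      (isOpen_lt continuous_const (hDcont z)) ⟨θ, hθ⟩
    exact Set.mem_iUnion.2 ⟨j, hz, Fin.last j, by simpa using hj⟩
  refine (measure_mono hsub).trans ?_
  -- Continuity from below holds for increasing unions of arbitrary sets, so neither a union bound
  -- nor measurability of `G` is needed: every `S N` has measure at most `δ`.
  rw [hmono.measure_iUnion]
  refine iSup_le fun N => ?_
  have h := measureReal_maxDeviation_gt_le μ hn (f := fun j : Fin (N + 1) => f (u j))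
    (fun j => hf _) (fun j => h01 _) hδ hδ1
  refine (measure_mono ?_).trans ((ENNReal.le_ofReal_iff_toReal_le (measure_ne_top _ _) hδ.le).2 h)
  rintro z ⟨hz, j, hj⟩
  have h1 := hβ z hz N fun j => u j
  have h2 : D (u j) z ≤ maxDeviation μ (fun j : Fin (N + 1) => f (u j)) z :=
    le_ciSup (f := fun j : Fin (N + 1) => D (u j) z) (Set.finite_range _).bddAbove j
  have : 2 * rademacher (fun (a : Fin (N + 1)) i => f (u a) (z i)) + τ ≤
      maxDeviation μ (fun j : Fin (N + 1) => f (u j)) z := by linarith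
  exact this

/-! ### Margin and ramp loss -/

section Loss

/-- The coordinate at `y` and the maximum over the other coordinates are each 1-Lipschitz. -/
theorem abs_margin_sub_le {k : ℕ} (v w : E k) (y : Fin k) :
    |margin v y - margin w y| ≤ 2 * ‖v - w‖ := by
  have hc : ∀ j, |v j - w j| ≤ ‖v - w‖ := fun j => by
    simpa using PiLp.norm_apply_le (v - w) j
  have hs : |(⨆ j : {j : Fin k // j ≠ y}, v j) - ⨆ j : {j : Fin k // j ≠ y}, w j| ≤ ‖v - w‖ := by
    rcases isEmpty_or_nonempty {j : Fin k // j ≠ y} with h | h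
    -- With a single class both suprema are over the empty set and equal 0.
    · simp
    · refine abs_sub_le_iff.2 ⟨sub_le_iff_le_add'.2 ?_, sub_le_iff_le_add'.2 ?_⟩
      · exact ciSup_le_ciSup_add fun j => by linarith [(abs_le.1 (hc j)).2]
      · exact ciSup_le_ciSup_add fun j => by linarith [(abs_le.1 (hc j)).1]
  have e : margin v y - margin w y = (v y - w y) -
      ((⨆ j : {j : Fin k // j ≠ y}, v j) - ⨆ j : {j : Fin k // j ≠ y}, w j) := by
    simp only [margin]
    ring
  rw [e, two_mul]
  exact (abs_sub _ _).trans (add_le_add (hc y) hs)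

theorem continuous_margin {k : ℕ} (y : Fin k) : Continuous fun v : E k => margin v y :=
  (LipschitzWith.of_dist_le_mul (K := 2) fun v w => by
    simpa [Real.dist_eq, dist_eq_norm] using abs_margin_sub_le v w y).continuous

theorem margin_nonpos_of_argmax_ne {k : ℕ} {am : E k → Fin k} (ham : IsArgmax am) {v : E k}
    {y : Fin k} (h : am v ≠ y) : margin v y ≤ 0 := by
  have := le_ciSup (f := fun j : {j : Fin k // j ≠ y} => v j) (Set.finite_range _).bddAbove
    ⟨am v, h⟩
  exact sub_nonpos.2 ((ham v y).trans this)

theorem ramp_eq {γ : ℝ} (hγ : 0 < γ) (r : ℝ) : ramp γ r = max 0 (min 1 (1 + r / γ)) := by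
  rw [ramp]
  split_ifs with h1 h2
  · have : r / γ < -1 := by rwa [div_lt_iff₀ hγ, neg_one_mul]
    rw [max_eq_left ((min_le_right _ _).trans (by linarith))]
  · have h3 : -1 ≤ r / γ := by
      rw [le_div_iff₀ hγ]
      linarith
    have h4 : r / γ ≤ 0 := div_nonpos_of_nonpos_of_nonneg h2 hγ.le
    rw [min_eq_right (by linarith), max_eq_right (by linarith)]
  · have h3 : 0 < r / γ := div_pos (not_le.1 h2) hγ
    rw [min_eq_left (by linarith), max_eq_right zero_le_one]

theorem ramp_mem_Icc {γ : ℝ} (hγ : 0 < γ) (r : ℝ) : ramp γ r ∈ Set.Icc (0 : ℝ) 1 := by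
  rw [ramp_eq hγ]
  exact ⟨le_max_left _ _, max_le zero_le_one (min_le_left _ _)⟩

theorem abs_ramp_sub_le {γ : ℝ} (hγ : 0 < γ) (r r' : ℝ) :
    |ramp γ r - ramp γ r'| ≤ |r - r'| / γ := by
  rw [ramp_eq hγ, ramp_eq hγ]
  have h1 := abs_max_sub_max_le_max 0 (min 1 (1 + r / γ)) 0 (min 1 (1 + r' / γ))
  have h2 := abs_min_sub_min_le_max 1 (1 + r / γ) 1 (1 + r' / γ)
  rw [sub_self, abs_zero,
    max_eq_right (abs_nonneg (min 1 (1 + r / γ) - min 1 (1 + r' / γ)))] at h1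
  rw [sub_self, abs_zero, max_eq_right (abs_nonneg (1 + r / γ - (1 + r' / γ)))] at h2
  refine (h1.trans h2).trans (le_of_eq ?_)
  rw [add_sub_add_left_eq_sub, ← sub_div, abs_div, abs_of_pos hγ]

theorem continuous_ramp {γ : ℝ} (hγ : 0 < γ) : Continuous (ramp γ) := by
  have : ramp γ = fun r => max 0 (min 1 (1 + r / γ)) := funext (ramp_eq hγ)
  rw [this]
  fun_prop

theorem one_le_ramp {γ : ℝ} (hγ : 0 < γ) {r : ℝ} (hr : 0 ≤ r) : 1 ≤ ramp γ r := by
  rw [ramp_eq hγ]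
  exact le_max_of_le_right (le_min le_rfl (by linarith [div_nonneg hr hγ.le]))

/-- The ramp loss of the margin of a predictor at a labelled point. -/
noncomputable def marginLoss {a k : ℕ} (γ : ℝ) (f : E a → E k) (p : E a × Fin k) : ℝ :=
  ramp γ (-margin (f p.1) p.2)

theorem marginLoss_mem_Icc {a k : ℕ} {γ : ℝ} (hγ : 0 < γ) (f : E a → E k) (p : E a × Fin k) :
    marginLoss γ f p ∈ Set.Icc (0 : ℝ) 1 :=
  ramp_mem_Icc hγ _

theorem measurable_marginLoss {a k : ℕ} {γ : ℝ} (hγ : 0 < γ) {f : E a → E k} (hf : Continuous f) :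
    Measurable (marginLoss γ f) :=
  measurable_from_prod_countable_left fun y =>
    ((continuous_ramp hγ).comp ((continuous_margin y).comp hf).neg).measurable

/-- Markov's inequality at level 1: a misclassified point has nonpositive margin, whichever way ties
are broken, so its loss is at least 1. -/
theorem errorProb_le_integral_marginLoss {a k : ℕ} {γ : ℝ} (hγ : 0 < γ)
    (μ : Measure (E a × Fin k)) [IsProbabilityMeasure μ] {am : E k → Fin k} (ham : IsArgmax am)
    {f : E a → E k} (hf : Continuous f) :
    errorProb μ am f ≤ ∫ p, marginLoss γ f p ∂μ := by
  have hint : Integrable (marginLoss γ f) μ :=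
    integrable_of_abs_le (measurable_marginLoss hγ hf) (K := 1) fun p => by
      rw [abs_of_nonneg (marginLoss_mem_Icc hγ f p).1]
      exact (marginLoss_mem_Icc hγ f p).2
  have h := mul_meas_ge_le_integral_of_nonneg
    (Filter.Eventually.of_forall fun p => (marginLoss_mem_Icc hγ f p).1) hint 1
  rw [one_mul] at h
  refine (measureReal_mono fun p hp => ?_).trans h
  exact one_le_ramp hγ (neg_nonneg.2 (margin_nonpos_of_argmax_ne ham hp))

/-- A batch cover of the outputs of predictors yields a cover of their loss vectors. -/
theorem sum_ramp_sub_sq_le {n k : ℕ} {γ : ℝ} (hγ : 0 < γ) (V W : Batch n k) (y : Fin n → Fin k)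
    {ε : ℝ} (h : ‖V - W‖ ≤ ε * γ / 2) :
    ∑ i, (ramp γ (-margin (V i) (y i)) - ramp γ (-margin (W i) (y i))) ^ 2 ≤ ε ^ 2 := by
  have h1 : ∀ i, (ramp γ (-margin (V i) (y i)) - ramp γ (-margin (W i) (y i))) ^ 2 ≤
      (2 / γ) ^ 2 * ‖(V - W) i‖ ^ 2 := by
    intro i
    rw [← mul_pow, ← sq_abs]
    refine pow_le_pow_left₀ (abs_nonneg _) ((abs_ramp_sub_le hγ _ _).trans ?_) 2
    rw [div_mul_eq_mul_div, neg_sub_neg, abs_sub_comm]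
    exact div_le_div_of_nonneg_right (abs_margin_sub_le _ _ _) hγ.le
  refine (Finset.sum_le_sum fun i _ => h1 i).trans ?_
  rw [← Finset.mul_sum, ← PiLp.norm_sq_eq_of_L2, ← mul_pow]
  refine pow_le_pow_left₀ (by positivity) ?_ 2
  calc 2 / γ * ‖V - W‖ ≤ 2 / γ * (ε * γ / 2) := mul_le_mul_of_nonneg_left h (by positivity)
    _ = ε := by field_simp

end Loss

/-! ### Rademacher average of the network losses and numerical constants -/

section NetworkRisk

variable {L : ℕ} {d : Fin (L + 1) → ℕ} {m : Fin L → ℕ}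

theorem continuous_layerOutput {σ : ∀ i : Fin L, E (m i) → E (d i.succ)}
    (hσ : ∀ i, Continuous (σ i)) (l : Fin (L + 1)) :
    Continuous fun p : (∀ i : Fin L, Matrix (Fin (m i)) (Fin (d i.castSucc)) ℝ) × E (d 0) =>
      layerOutput σ p.1 l p.2 := by
  induction l using Fin.induction with
  | zero => exact continuous_snd
  | succ i ih =>
    simp only [layerOutput_succ, Matrix.toLpLin_apply]
    refine (hσ i).comp ((PiLp.continuous_toLp 2 _).comp (Continuous.matrix_mulVec ?_ ?_))
    · exact (continuous_apply i).comp continuous_fst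
    · exact (PiLp.continuous_ofLp 2 _).comp ih

theorem continuous_network {σ : ∀ i : Fin L, E (m i) → E (d i.succ)}
    (hσ : ∀ i, Continuous (σ i)) :
    Continuous fun p : (∀ i : Fin L, Matrix (Fin (m i)) (Fin (d i.castSucc)) ℝ) × E (d 0) =>
      network σ p.1 p.2 :=
  continuous_layerOutput hσ (Fin.last L)

theorem le_width_left (d : Fin (L + 1) → ℕ) (m : Fin L → ℕ) (l : Fin (L + 1)) :
    d l ≤ width d m :=
  (Finset.le_sup (f := d) (Finset.mem_univ l)).trans (le_max_left _ _)

theorem le_width_right (d : Fin (L + 1) → ℕ) (m : Fin L → ℕ) (i : Fin L) : m i ≤ width d m :=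
  (Finset.le_sup (f := m) (Finset.mem_univ i)).trans (le_max_right _ _)

theorem norm21_nonneg {a b : ℕ} (A : Matrix (Fin a) (Fin b) ℝ) : 0 ≤ norm21 A :=
  Finset.sum_nonneg fun _ _ => Real.sqrt_nonneg _

/-- The Rademacher average of finitely many networks with bounded weights. -/
theorem rademacher_marginLoss_le {n : ℕ} (hn : 0 < n)
    {σ : ∀ i : Fin L, E (m i) → E (d i.succ)} {ρ : Fin L → ℝ≥0}
    (hσ : ∀ i, LipschitzWith (ρ i) (σ i)) (hσ0 : ∀ i, σ i 0 = 0)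
    (M : ∀ i : Fin L, Matrix (Fin (m i)) (Fin (d i.castSucc)) ℝ)
    {γ : ℝ} (hγ : 0 < γ) {B : ℝ} {s b : Fin L → ℝ} (hs : ∀ i, 0 < s i)
    (hW : 1 ≤ width d m) {S : Fin n → E (d 0) × Fin (d (Fin.last L))}
    (hS : √(∑ i, ‖(S i).1‖ ^ 2) ≤ B) {ι : Type*} [Finite ι] [Nonempty ι]
    (A : ι → ∀ i : Fin L, Matrix (Fin (m i)) (Fin (d i.castSucc)) ℝ)
    (hA : ∀ a i, specNorm (A a i) ≤ s i) (hAM : ∀ a i, norm21 ((A a i)ᵀ - (M i)ᵀ) ≤ b i)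
    (N : ℕ) :
    rademacher (fun a i => marginLoss γ (network σ (A a)) (S i)) ≤ n / 2 ^ N +
      N * (6 * (2 / γ * (B * (∏ i, s i * (ρ i : ℝ)) *
        (∑ i, b i ^ (2 / 3 : ℝ) / s i ^ (2 / 3 : ℝ)) ^ (3 / 2 : ℝ)) *
          √(Real.log (2 * (width d m : ℝ) ^ 2)))) := by
  classical
  have hb : ∀ i, 0 ≤ b i := fun i => (norm21_nonneg _).trans (hAM (Classical.arbitrary ι) i)
  set X : Batch n (d 0) := WithLp.toLp 2 fun t => (S t).1 with hX
  have hXB : ‖X‖ ≤ B := by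
    rwa [← Real.sqrt_sq (norm_nonneg X), PiLp.norm_sq_eq_of_L2]
  have hB : 0 ≤ B := (norm_nonneg X).trans hXB
  set Q := B * (∏ i, s i * (ρ i : ℝ)) *
    (∑ i, b i ^ (2 / 3 : ℝ) / s i ^ (2 / 3 : ℝ)) ^ (3 / 2 : ℝ) with hQ
  have hQ0 : 0 ≤ Q := mul_nonneg (mul_nonneg hB
      (Finset.prod_nonneg fun i _ => mul_nonneg (hs i).le (ρ i).2))
    (Real.rpow_nonneg (Finset.sum_nonneg fun i _ => div_nonneg (Real.rpow_nonneg (hb i) _)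
      (Real.rpow_nonneg (hs i).le _)) _)
  have hW1 : (1 : ℝ) ≤ width d m := by exact_mod_cast hW
  have h2W : (1 : ℝ) ≤ 2 * (width d m : ℝ) ^ 2 := by nlinarith
  have hlog : 0 ≤ Real.log (2 * (width d m : ℝ) ^ 2) := Real.log_nonneg h2W
  refine rademacher_le_of_entropy hn (fun a => ?_) (by positivity) (fun ε hε => ?_) N
  · refine (Finset.sum_le_sum fun i _ => ?_).trans_eq (b := ∑ _i : Fin n, (1 : ℝ)) (by simp)
    have := marginLoss_mem_Icc hγ (network σ (A a)) (S i)
    exact pow_le_one₀ this.1 this.2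
  -- The loss is `2 / γ`-Lipschitz in the output, so outputs are covered at scale `ε * γ / 2`. A
  -- layer has at most `2 * W ^ 2` signed vertices, `W` being the width.
  · obtain ⟨K, C, hC, hK, hcov⟩ := exists_network_cover σ ρ hσ hσ0 M hs hb X hXB
      (N := 2 * width d m ^ 2) (by exact_mod_cast h2W) (fun i => by
        rw [pow_two]
        exact Nat.mul_le_mul_left 2
          (Nat.mul_le_mul (le_width_right d m i) (le_width_left d m i.castSucc)))
      (ε := ε * γ / 2) (by positivity)
    refine ⟨C.image fun (V : Batch n (d (Fin.last L))) i => ramp γ (-margin (V i) (S i).2),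
      ?_, fun a => ?_⟩
    · calc _ ≤ (C.card : ℝ) := by exact_mod_cast Finset.card_image_le
        _ ≤ (2 * (width d m : ℝ) ^ 2) ^ K := by exact_mod_cast hC
        _ = Real.exp (K * Real.log (2 * (width d m : ℝ) ^ 2)) := by
            rw [← Real.log_pow, Real.exp_log (by positivity)]
        _ ≤ _ := by
            rw [Real.exp_le_exp]
            refine (mul_le_mul_of_nonneg_right hK hlog).trans (le_of_eq ?_)
            rw [mul_pow _ (√_), Real.sq_sqrt hlog]
            field_simp
            ring
    · obtain ⟨V, hV, hd⟩ := hcov (A a) (hA a) (hAM a)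
      refine ⟨_, Finset.mem_image_of_mem _ hV, ?_⟩
      exact sum_ramp_sub_sq_le hγ (mapBatch (network σ (A a)) X) V (fun i => (S i).2) hd

/-- Change of base, using `log 2 > 2 / 3`. -/
theorem natLog_two_mul_le (n : ℕ) (hn : 0 < n) : 2 * (Nat.log 2 n : ℝ) ≤ 3 * Real.log n := by
  have h1 : ((2 : ℝ) ^ Nat.log 2 n) ≤ n := by exact_mod_cast Nat.pow_log_le_self 2 hn.ne'
  have h2 := Real.log_le_log (by positivity) h1
  rw [Real.log_pow] at h2
  have h3 := Real.log_two_gt_d9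
  have h4 : (0 : ℝ) ≤ Nat.log 2 n := Nat.cast_nonneg _
  nlinarith

theorem sqrt_log_two_mul_sq_le {W : ℝ} (hW : 1 ≤ W) :
    √(Real.log (2 * W ^ 2)) ≤ 2 * Real.log (2 * W) := by
  have h0 : 0 ≤ Real.log W := Real.log_nonneg hW
  have h2 := Real.log_two_gt_d9
  rw [Real.log_mul two_ne_zero (by positivity), Real.log_mul two_ne_zero (by positivity),
    Real.log_pow]
  refine Real.sqrt_le_iff.2 ⟨by linarith, ?_⟩
  push_cast
  nlinarith

/-- With `Nat.log 2 n` scales the residual `n / 2 ^ Nat.log 2 n` is at most 2, which after doubling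
fits into 8. The constant is `72 = 2 * 6 * 2 * (3 / 2) * 2`, from symmetrization, the cost per
scale, the Lipschitz constant `2 / γ`, the change of base and the square root of the logarithm. -/
theorem complexity_term_le {n : ℕ} (hn : 0 < n) {W Q γ : ℝ} (hW : 1 ≤ W) (hQ : 0 ≤ Q)
    (hγ : 0 < γ) :
    2 * (n / 2 ^ Nat.log 2 n + Nat.log 2 n * (6 * (2 / γ * Q * √(Real.log (2 * W ^ 2))))) ≤
      n * (8 / n + 72 * Real.log (2 * W) * Real.log n / (γ * n) * Q) := by
  have hn0 : (0 : ℝ) < n := by exact_mod_cast hn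
  have h1 : (n : ℝ) / 2 ^ Nat.log 2 n ≤ 2 := by
    rw [div_le_iff₀ (by positivity)]
    have := (Nat.lt_pow_succ_log_self one_lt_two n).le
    rw [pow_succ, mul_comm] at this
    exact_mod_cast this
  have h2 : (Nat.log 2 n : ℝ) * √(Real.log (2 * W ^ 2)) ≤
      (3 / 2 * Real.log n) * (2 * Real.log (2 * W)) :=
    mul_le_mul (by linarith [natLog_two_mul_le n hn]) (sqrt_log_two_mul_sq_le hW)
      (Real.sqrt_nonneg _) (by
        have := Real.log_nonneg (show (1 : ℝ) ≤ n by exact_mod_cast hn)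
        positivity)
  have h3 := mul_le_mul_of_nonneg_left h2 (show 0 ≤ 24 / γ * Q by positivity)
  have e : n * (8 / n + 72 * Real.log (2 * W) * Real.log n / (γ * n) * Q) =
      8 + 24 / γ * Q * ((3 / 2 * Real.log n) * (2 * Real.log (2 * W))) := by
    field_simp
    ring
  rw [e]
  have e2 : 2 * ((n : ℝ) / 2 ^ Nat.log 2 n +
        Nat.log 2 n * (6 * (2 / γ * Q * √(Real.log (2 * W ^ 2))))) =
      2 * ((n : ℝ) / 2 ^ Nat.log 2 n) + 24 / γ * Q * (Nat.log 2 n * √(Real.log (2 * W ^ 2))) := by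
    ring
  rw [e2]
  linarith

end NetworkRisk

end SpectralMargin

/-! ### Assembly of the margin bound -/

open SpectralMargin

theorem mainTheorem6
    {L : ℕ} (d : Fin (L + 1) → ℕ) (m : Fin L → ℕ)
    (σ : ∀ i : Fin L, SpectralMargin.E (m i) → SpectralMargin.E (d i.succ))
    (ρ : Fin L → ℝ≥0)
    (hσ : ∀ i, LipschitzWith (ρ i) (σ i)) (hσ0 : ∀ i, σ i 0 = 0)
    (M : ∀ i : Fin L, Matrix (Fin (m i)) (Fin (d i.castSucc)) ℝ)
    (am : SpectralMargin.E (d (Fin.last L)) → Fin (d (Fin.last L)))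
    (ham : SpectralMargin.IsArgmax am)
    (γ : ℝ) (hγ : 0 < γ) (B : ℝ)
    (s b : Fin L → ℝ) (hs : ∀ i, 0 < s i)
    (μ : Measure (SpectralMargin.E (d 0) × Fin (d (Fin.last L)))) [IsProbabilityMeasure μ]
    (n : ℕ) (hn : 0 < n) (δ : ℝ) (hδ : 0 < δ) (hδ1 : δ ≤ 1) :
    1 - δ ≤ (Measure.pi fun _ : Fin n => μ).real
      {S | Real.sqrt (∑ i, ‖(S i).1‖ ^ 2) ≤ B →
        ∀ A : ∀ i : Fin L, Matrix (Fin (m i)) (Fin (d i.castSucc)) ℝ,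
          (∀ i, SpectralMargin.specNorm (A i) ≤ s i) →
          (∀ i, SpectralMargin.norm21 ((A i)ᵀ - (M i)ᵀ) ≤ b i) →
          SpectralMargin.errorProb μ am (SpectralMargin.network σ A) ≤
            SpectralMargin.empRampRisk γ (SpectralMargin.network σ A) S
            + 8 / n
            + 72 * B * Real.log (2 * (SpectralMargin.width d m : ℝ)) * Real.log n / (γ * n)
              * (∏ i, s i * (ρ i : ℝ))
              * (∑ i, b i ^ (2 / 3 : ℝ) / s i ^ (2 / 3 : ℝ)) ^ (3 / 2 : ℝ)
            + 3 * Real.sqrt (Real.log (1 / δ) / (2 * n))} := by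
  have hn0 : (0 : ℝ) < n := by exact_mod_cast hn
  -- The classification rule takes a value in the label set, so there is at least one class and the
  -- output dimension is positive.
  have hW : 1 ≤ width d m :=
    (Fin.pos (am 0)).trans_le (le_width_left d m (Fin.last L))
  have hW1 : (1 : ℝ) ≤ width d m := by exact_mod_cast hW
  have hσc : ∀ i, Continuous (σ i) := fun i => (hσ i).continuous
  set Θ : Set (∀ i : Fin L, Matrix (Fin (m i)) (Fin (d i.castSucc)) ℝ) := {A |
    (∀ i, specNorm (A i) ≤ s i) ∧ ∀ i, norm21 ((A i)ᵀ - (M i)ᵀ) ≤ b i}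
  have : ∀ i : Fin L, SecondCountableTopology (Matrix (Fin (m i)) (Fin (d i.castSucc)) ℝ) :=
    fun i => inferInstanceAs (SecondCountableTopology (Fin (m i) → Fin (d i.castSucc) → ℝ))
  set Q := B * (∏ i, s i * (ρ i : ℝ)) *
    (∑ i, b i ^ (2 / 3 : ℝ) / s i ^ (2 / 3 : ℝ)) ^ (3 / 2 : ℝ) with hQ
  set ν := Measure.pi fun _ : Fin n => μ with hν
  have hnet : ∀ A : ∀ i : Fin L, Matrix (Fin (m i)) (Fin (d i.castSucc)) ℝ,
      Continuous (network σ A) := fun A => (continuous_network hσc).comp (Continuous.prodMk_right A)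
  have key := measure_exists_deviation_gt_le μ hn
    (f := fun (θ : Θ) p => marginLoss γ (network σ θ.1) p)
    (fun θ => measurable_marginLoss hγ (hnet θ.1))
    (fun p => (continuous_ramp hγ).comp ((continuous_margin p.2).comp
      ((continuous_network hσc).comp
        (continuous_subtype_val.prodMk continuous_const))).neg)
    (fun θ p => marginLoss_mem_Icc hγ _ p) hδ hδ1
    (G := {S | √(∑ i, ‖(S i).1‖ ^ 2) ≤ B})
    (fun S hS N g => rademacher_marginLoss_le hn hσ hσ0 M hγ hs hW hS (fun a => (g a).1)
      (fun a => (g a).2.1) (fun a => (g a).2.2) (Nat.log 2 n))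
  rw [← hQ, ← hν] at key
  set bad : Set (Fin n → E (d 0) × Fin (d (Fin.last L))) := _
  change ν bad ≤ _ at key
  have hbad : ν.real bad ≤ δ := ENNReal.toReal_le_of_le_ofReal hδ.le key
  set good : Set (Fin n → E (d 0) × Fin (d (Fin.last L))) := _
  change 1 - δ ≤ ν.real good
  -- Subadditivity applied to this cover bounds the measure of `good` from below without
  -- measurability of either set.
  have hcover : Set.univ ⊆ good ∪ bad := by
    intro S _
    rw [Set.mem_union, or_iff_not_imp_right]
    intro hS hSB A hA hAM
    have hdev : ∑ i, (∫ p, marginLoss γ (network σ A) p ∂μ - marginLoss γ (network σ A) (S i)) ≤ _ :=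
      not_lt.1 fun h => hS ⟨hSB, ⟨A, hA, hAM⟩, h⟩
    -- The signs of `b` and `B` are not assumed: an admissible `A` and a sample within the data
    -- bound force them to be nonnegative.
    have hb : ∀ i, 0 ≤ b i := fun i => (norm21_nonneg _).trans (hAM i)
    have hQ0 : 0 ≤ Q := mul_nonneg (mul_nonneg ((Real.sqrt_nonneg _).trans hSB)
        (Finset.prod_nonneg fun i _ => mul_nonneg (hs i).le (ρ i).2))
      (Real.rpow_nonneg (Finset.sum_nonneg fun i _ => div_nonneg (Real.rpow_nonneg (hb i) _)
        (Real.rpow_nonneg (hs i).le _)) _)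
    have hcomp := complexity_term_le hn hW1 hQ0 hγ
    have herr := errorProb_le_integral_marginLoss hγ μ ham (hnet A)
    rw [Finset.sum_sub_distrib, Finset.sum_const, Finset.card_univ, Fintype.card_fin,
      nsmul_eq_mul] at hdev
    have hemp : ∑ i, marginLoss γ (network σ A) (S i) = n * empRampRisk γ (network σ A) S := by
      rw [empRampRisk, mul_inv_cancel_left₀ hn0.ne']
      rfl
    rw [hemp] at hdev
    have hfin : n * ∫ p, marginLoss γ (network σ A) p ∂μ ≤
        n * (empRampRisk γ (network σ A) S + 8 / n +
          72 * Real.log (2 * (width d m : ℝ)) * Real.log n / (γ * n) * Q +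
          3 * √(Real.log (1 / δ) / (2 * n))) := by
      linarith
    refine (herr.trans (le_of_mul_le_mul_left hfin hn0)).trans (le_of_eq ?_)
    rw [hQ]
    ring
  have hone : (1 : ℝ) ≤ ν.real good + ν.real bad := by
    rw [← probReal_univ (μ := ν)]
    exact (measureReal_mono hcover).trans (measureReal_union_le _ _)
  linarith
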